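/- Let $\tilde\gamma>0$ and, for every $N\ge 1$, let $\gamma_1,\dots,\gamma_N\in[0,\tilde\gamma]$ (with $\gamma_i=\gamma_i^{(N)}$) be such that the empirical measures $N^{-1}\sum_{i\le N}\delta_{\gamma_i}$ converge in the $1$-Wasserstein metric, as $N\to\infty$, to a probability measure $\rho$ on $\mathbb{R}$. For $g\in\mathbb{R}^N\setminus\{0\}$ put $H_N(g)=N\sum_{i\le N}\gamma_i g_i^2/\|g\|^2$ and $h_N=H_N/N$. For $\theta\in\mathbb{R}$ let $$\langle f(g)\rangle=\langle f(g)\rangle_\theta:=\frac1{Z_N(\theta)}\int_{\mathbb{R}^N}f(g)\,e^{\theta H_N(g)}\,dG(g),\qquad Z_N(\theta):=\int_{\mathbb{R}^N} e^{\theta H_N(g)}\,dG(g),$$ be the Gibbs mean, where $G$ is the standard normal measure on $\mathbb{R}^N$. Let $S_\rho(z)=\int_{[0,\tilde\gamma]}\rho(d\gamma)/(z-\gamma)$ for $z\in\mathbb{R}\setminus[0,\tilde\gamma]$, let $S_{max}=\lim_{z\downarrow\tilde\gamma}S_\rho(z)$ and $S_{min}=\lim_{z\uparrow0}S_\rho(z)$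 (possibly infinite), let $K_\rho:(S_{min},S_{max})\setminus\{0\}\to\mathbb{R}\setminus[0,\tilde\gamma]$ be the inverse of $S_\rho$, and let $R_\rho(x)=K_\rho(x)-1/x$. Put $T_\rho=(S_{min}/2,S_{max}/2)\setminus\{0\}$ and, for $\theta\in T_\rho$, $$v(\theta)=R_\rho(2\theta),\qquad a_N(\theta)=\big\langle(h_N-v(\theta))^2\big\rangle_\theta,\qquad \tilde a_N(\theta)=\frac1{\sqrt N}+\sqrt{a_N(\theta)}.$$ Let $\theta\in T_\rho$ and $k\ge1$. Then $1+2\theta(v(\theta)-\gamma)>0$ for all $\gamma\in[0,\tilde\gamma]$. Let $\mu_\gamma$ be the centred normal law on $\mathbb{R}$ of variance $1/(1+2\theta(v(\theta)-\gamma))$. (i) There is a constant $K'(\theta,k)>0$, independent of $N$, of the indices and of $f$, such that for every $N$, all distinct indices $d_1,\dots,d_k\in\{1,\dots,N\}$ and every bounded measurable $f:\mathbb{R}^k\to\mathbb{R}$, $$\Big|\langle f(g_{d_1},\dots,g_{d_k})\rangle-\int_{\mathbb{R}^k}f(x_1,\dots,x_k)\,d\mu_{\gamma_{d_1}}(x_1)\cdots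 d\mu_{\gamma_{d_k}}(x_k)\Big|\le K'(\theta,k)\,\|f\|_\infty\,\tilde a_N(\theta).$$ (ii) $\tilde a_N(\theta)\to0$ as $N\to\infty$. (iii) Consequently the finite marginals converge weakly to independent Gaussians: along any sequence of sizes $N\to\infty$ and any choice of $k$ distinct indices $d_1,\dots,d_k\le N$ (which may depend on $N$), the difference on the left-hand side of (i) tends to $0$ for every bounded continuous $f$; and if moreover $\gamma_{d_i}^{(N)}\to c_i$ for $i=1,\dots,k$, then the law of $(g_{d_1},\dots,g_{d_k})$ under $\langle\cdot\rangle$ converges weakly to $\mu_{c_1}\otimes\cdots\otimes\mu_{c_k}$. -/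

import Mathlib

open MeasureTheory ProbabilityTheory Filter Topology Set
open scoped ENNReal NNReal BoundedContinuousFunction

noncomputable section

namespace SphericalModel

/-- The `1`-Wasserstein distance on `ℝ`: the infimum of the transport cost `∫ |x - y| dπ(x, y)`
over all couplings `π` of `μ` and `ν` (it is `∞` if there is no coupling). -/
def wasserstein1 (μ ν : Measure ℝ) : ℝ≥0∞ :=
  ⨅ π ∈ {π : Measure (ℝ × ℝ) | π.map Prod.fst = μ ∧ π.map Prod.snd = ν},
    ∫⁻ p, edist p.1 p.2 ∂π

/-- The empirical measure `N⁻¹ ∑ i, δ_{c i}` of a family of `N` real numbers. -/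
def empiricalMeasure {N : ℕ} (c : Fin N → ℝ) : Measure ℝ :=
  (N : ℝ≥0∞)⁻¹ • ∑ i, Measure.dirac (c i)

/-- The standard normal measure on `ℝ^N`. -/
def stdNormal (N : ℕ) : Measure (Fin N → ℝ) :=
  Measure.pi fun _ => gaussianReal 0 1

/-- The Hamiltonian `H_N(g) = N ∑ i, c i * g i ^ 2 / ‖g‖ ^ 2`, with the Euclidean norm. -/
def hamiltonian {N : ℕ} (c : Fin N → ℝ) (g : Fin N → ℝ) : ℝ :=
  N * ∑ i, c i * (g i ^ 2 / ∑ j, g j ^ 2)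

/-- The intensive energy `h_N = H_N / N`. -/
def energy {N : ℕ} (c : Fin N → ℝ) (g : Fin N → ℝ) : ℝ :=
  hamiltonian c g / N

/-- The partition function `Z_N(θ)`. -/
def partitionFunction {N : ℕ} (c : Fin N → ℝ) (θ : ℝ) : ℝ :=
  ∫ g, Real.exp (θ * hamiltonian c g) ∂(stdNormal N)

/-- The Gibbs mean `⟨f⟩_θ`. -/
def gibbsMean {N : ℕ} (c : Fin N → ℝ) (θ : ℝ) (f : (Fin N → ℝ) → ℝ) : ℝ :=
  1 / partitionFunction c θ * ∫ g, f g * Real.exp (θ * hamiltonian c g) ∂(stdNormal N)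

/-- The Stieltjes transform `S_ρ(z) = ∫_{[0, b]} ρ(dx) / (z - x)`, used for `z ∉ [0, b]`. -/
def stieltjes (ρ : Measure ℝ) (b z : ℝ) : ℝ :=
  ∫ x in Icc 0 b, 1 / (z - x) ∂ρ

/-- `S_max`, the possibly infinite limit of `S_ρ(z)` as `z` decreases to `b`. -/
def stieltjesMax (ρ : Measure ℝ) (b : ℝ) : EReal :=
  limUnder (𝓝[>] b) fun z => (stieltjes ρ b z : EReal)

/-- `S_min`, the possibly infinite limit of `S_ρ(z)` as `z` increases to `0`. -/
def stieltjesMin (ρ : Measure ℝ) (b : ℝ) : EReal :=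
  limUnder (𝓝[<] (0 : ℝ)) fun z => (stieltjes ρ b z : EReal)

/-- The high-temperature region `T_ρ = (S_min / 2, S_max / 2) \ {0}`. -/
def highTemp (ρ : Measure ℝ) (b : ℝ) : Set ℝ :=
  {θ | stieltjesMin ρ b < ((2 * θ : ℝ) : EReal) ∧ ((2 * θ : ℝ) : EReal) < stieltjesMax ρ b ∧
    θ ≠ 0}

/-- The inverse `K_ρ` of `S_ρ : ℝ \ [0, b] → (S_min, S_max) \ {0}`. -/
def stieltjesInv (ρ : Measure ℝ) (b : ℝ) : ℝ → ℝ :=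
  Function.invFunOn (stieltjes ρ b) (Icc 0 b)ᶜ

/-- The R-transform `R_ρ(x) = K_ρ(x) - 1 / x`. -/
def rTransform (ρ : Measure ℝ) (b x : ℝ) : ℝ :=
  stieltjesInv ρ b x - 1 / x

/-- The limiting energy `v(θ) = R_ρ(2θ)`. -/
def limitEnergy (ρ : Measure ℝ) (b θ : ℝ) : ℝ :=
  rTransform ρ b (2 * θ)

/-- `a_N(θ) = ⟨(h_N - v(θ))²⟩_θ`. -/
def energyError (ρ : Measure ℝ) (b θ : ℝ) {N : ℕ} (c : Fin N → ℝ) : ℝ :=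
  gibbsMean c θ fun g => (energy c g - limitEnergy ρ b θ) ^ 2

/-- The rate `1 / √N + √(a_N(θ))`. -/
def rate (ρ : Measure ℝ) (b θ : ℝ) {N : ℕ} (c : Fin N → ℝ) : ℝ :=
  1 / √(N : ℝ) + √(energyError ρ b θ c)

/-- The centred Gaussian law `μ_x` with variance `1 / (1 + 2θ(v(θ) - x))`. -/
def marginalLaw (ρ : Measure ℝ) (b θ x : ℝ) : Measure ℝ :=
  gaussianReal 0 (Real.toNNReal (1 / (1 + 2 * θ * (limitEnergy ρ b θ - x))))

end SphericalModel

end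

/-!
Write `RG(l)` for the law with density proportional to `exp (-N * rayleigh l g / 2)` with respect to
the standard normal law. As the Rayleigh quotient changes by a constant when a constant is added to
all the weights, the Gibbs measure is `RG(l)` for `l i = 1 + 2θ(w - γ i)`, whatever the level `w`.
If `N⁻¹ ∑ i, 1 / l i = 1`, which is the equation `S(K) = 2θ` for the empirical Stieltjes transform
at `K = w + 1 / (2θ)`, then the Gaussian vector with precisions `l i` has expected squared length
`N`. Since its length and direction decouple, Jensen's inequality in the length shows that under
`RG(l)` the direction is dominated, up to a factor independent of `N`, by the direction of that
Gaussian vector. Hence the Rayleigh quotient concentrates and the coordinates have bounded fourth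
moments. Convergence of the Stieltjes transforms moves the solution `w` to `v(θ)`, so the energy
concentrates at `v(θ)`.

For the marginals take the weights at `w = v(θ)` and adjoin to `g` an independent vector `x` with
law `∏ j, μ_{γ (d j)}`. Exchanging `g (d j)` and `x j` for all `j` preserves the standard normal law
of the pair, and it changes the log-density of the pair by an amount which is small in `L¹` because
the energy and the length concentrate. So the laws of `(g (d j))_j` and of `x` are close.
-/

namespace SphericalModel

section Wasserstein

variable {ι : Type*} {l : Filter ι} {μ : ι → Measure ℝ} {ρ : Measure ℝ}

theorem ofReal_abs_integral_sub_le_mul_wasserstein1 {μ ν : Measure ℝ} [IsProbabilityMeasure μ]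
    {L : ℝ≥0} (hL : L ≠ 0) {φ : ℝ → ℝ} (hφ : LipschitzWith L φ) {B : ℝ} (hB : ∀ x, |φ x| ≤ B) :
    ENNReal.ofReal |∫ x, φ x ∂μ - ∫ x, φ x ∂ν| ≤ L * wasserstein1 μ ν := by
  have hL' : (L : ℝ≥0∞) ≠ 0 := by simpa using hL
  rw [← ENNReal.div_le_iff' hL' ENNReal.coe_ne_top]
  refine le_iInf₂ fun π ⟨hfst, hsnd⟩ => ?_
  rw [ENNReal.div_le_iff' hL' ENNReal.coe_ne_top]
  have : IsProbabilityMeasure (π.map Prod.fst) := hfst ▸ inferInstance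
  have : IsProbabilityMeasure π := Measure.isProbabilityMeasure_of_map Prod.fst
  have hm : Measurable φ := hφ.continuous.measurable
  have hint (p : ℝ × ℝ → ℝ) (hp : Measurable p) : Integrable (fun x => φ (p x)) π :=
    .of_bound (hm.comp hp).aestronglyMeasurable B (ae_of_all _ fun x => hB (p x))
  rw [← hfst, ← hsnd, integral_map measurable_fst.aemeasurable hm.aestronglyMeasurable,
    integral_map measurable_snd.aemeasurable hm.aestronglyMeasurable,
    ← integral_sub (hint _ measurable_fst) (hint _ measurable_snd),
    ← lintegral_const_mul _ (by fun_prop), ← Real.enorm_eq_ofReal_abs]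
  refine (enorm_integral_le_lintegral_enorm _).trans (lintegral_mono fun p => ?_)
  rw [← edist_eq_enorm_sub]
  exact hφ p.1 p.2

theorem tendsto_integral_of_tendsto_wasserstein1 (hμ : ∀ᶠ n in l, IsProbabilityMeasure (μ n))
    (hρ : Tendsto (fun n => wasserstein1 (μ n) ρ) l (𝓝 0))
    {L : ℝ≥0} {φ : ℝ → ℝ} (hφ : LipschitzWith L φ) {B : ℝ} (hB : ∀ x, |φ x| ≤ B) :
    Tendsto (fun n => ∫ x, φ x ∂(μ n)) l (𝓝 (∫ x, φ x ∂ρ)) := by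
  rw [tendsto_iff_edist_tendsto_0]
  have hmul : Tendsto (fun n => ((L + 1 : ℝ≥0) : ℝ≥0∞) * wasserstein1 (μ n) ρ) l (𝓝 0) := by
    simpa only [mul_zero] using ENNReal.Tendsto.const_mul hρ (.inr ENNReal.coe_ne_top)
  refine tendsto_of_tendsto_of_tendsto_of_le_of_le' tendsto_const_nhds hmul
    (.of_forall fun _ => zero_le) ?_
  filter_upwards [hμ] with n _
  rw [edist_dist, Real.dist_eq]
  exact ofReal_abs_integral_sub_le_mul_wasserstein1 (by positivity) (hφ.weaken (by simp)) hB

theorem ae_mem_of_tendsto_wasserstein1 [l.NeBot] [IsFiniteMeasure ρ]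
    (hμ : ∀ᶠ n in l, IsProbabilityMeasure (μ n))
    (hρ : Tendsto (fun n => wasserstein1 (μ n) ρ) l (𝓝 0))
    {s : Set ℝ} (hs : IsClosed s) (hs₀ : s.Nonempty) (hμs : ∀ᶠ n in l, ∀ᵐ x ∂(μ n), x ∈ s) :
    ∀ᵐ x ∂ρ, x ∈ s := by
  set φ : ℝ → ℝ := fun x => min 1 (Metric.infDist x s)
  have hφ : LipschitzWith 1 φ := (Metric.lipschitz_infDist_pt s).const_min 1
  have hφ₀ (x : ℝ) : 0 ≤ φ x := le_min zero_le_one Metric.infDist_nonneg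
  have hφ₁ (x : ℝ) : |φ x| ≤ 1 := by rw [abs_of_nonneg (hφ₀ x)]; exact min_le_left _ _
  have hφs (x : ℝ) : φ x = 0 ↔ x ∈ s := by
    rw [hs.mem_iff_infDist_zero hs₀]
    constructor
    · intro h
      by_contra hne
      exact absurd h (lt_min one_pos (Metric.infDist_nonneg.lt_of_ne' hne)).ne'
    · intro h
      simp only [φ, h, zero_le_one, inf_of_le_right]
  have hlim := tendsto_integral_of_tendsto_wasserstein1 hμ hρ hφ hφ₁
  have hzero : ∀ᶠ n in l, ∫ x, φ x ∂(μ n) = 0 := by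
    filter_upwards [hμs] with n hn
    exact integral_eq_zero_of_ae (hn.mono fun x hx => (hφs x).2 hx)
  have hint : ∫ x, φ x ∂ρ = 0 :=
    tendsto_nhds_unique hlim (tendsto_const_nhds.congr' (EventuallyEq.symm hzero))
  rw [integral_eq_zero_iff_of_nonneg hφ₀
    (.of_bound hφ.continuous.aestronglyMeasurable 1 (ae_of_all _ hφ₁))] at hint
  exact hint.mono fun x hx => (hφs x).1 hx

end Wasserstein

section EmpiricalMeasure

variable {N : ℕ}

instance isProbabilityMeasure_empiricalMeasure [NeZero N] (c : Fin N → ℝ) :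
    IsProbabilityMeasure (empiricalMeasure c) := by
  refine ⟨?_⟩
  simp only [empiricalMeasure, Measure.smul_apply, Measure.finsetSum_apply, measure_univ,
    Finset.sum_const, Finset.card_univ, Fintype.card_fin, smul_eq_mul, nsmul_eq_mul, mul_one]
  exact ENNReal.inv_mul_cancel (by simpa using NeZero.ne N) (ENNReal.natCast_ne_top _)

theorem integral_empiricalMeasure (c : Fin N → ℝ) (φ : ℝ → ℝ) :
    ∫ x, φ x ∂(empiricalMeasure c) = (N : ℝ)⁻¹ * ∑ i, φ (c i) := by
  rw [empiricalMeasure, integral_smul_measure,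
    integral_finsetSum_measure fun i _ => integrable_dirac (by simp)]
  simp

theorem ae_empiricalMeasure_of_forall {c : Fin N → ℝ} {p : ℝ → Prop} (h : ∀ i, p (c i)) :
    ∀ᵐ x ∂(empiricalMeasure c), p x := by
  refine Measure.ae_smul_measure ?_ _
  rw [← Measure.sum_fintype, Measure.ae_sum_iff]
  simpa [ae_dirac_eq] using h

theorem stieltjes_empiricalMeasure {b : ℝ} {c : Fin N → ℝ} (hc : ∀ i, c i ∈ Icc 0 b) (z : ℝ) :
    stieltjes (empiricalMeasure c) b z = (N : ℝ)⁻¹ * ∑ i, 1 / (z - c i) := by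
  rw [stieltjes, Measure.restrict_eq_self_of_ae_mem (ae_empiricalMeasure_of_forall hc),
    integral_empiricalMeasure]

end EmpiricalMeasure

section Stieltjes

variable {b z : ℝ} {ρ : Measure ℝ}

theorem exists_pos_forall_le_abs_sub (hz : z ∉ Icc 0 b) : ∃ δ > 0, ∀ x ∈ Icc 0 b, δ ≤ |z - x| := by
  obtain ⟨δ, hδ, hball⟩ := Metric.mem_nhds_iff.1 (isClosed_Icc.isOpen_compl.mem_nhds hz)
  refine ⟨δ, hδ, fun x hx => not_lt.1 fun hlt => hball ?_ hx⟩
  rwa [Metric.mem_ball, dist_comm, Real.dist_eq]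

theorem sub_ne_zero_of_notMem_Icc (hz : z ∉ Icc 0 b) {x : ℝ} (hx : x ∈ Icc 0 b) : z - x ≠ 0 :=
  sub_ne_zero.2 fun h => hz (h ▸ hx)

theorem integrableOn_one_div_sub [IsFiniteMeasure ρ] (hz : z ∉ Icc 0 b) :
    IntegrableOn (fun x => 1 / (z - x)) (Icc 0 b) ρ := by
  obtain ⟨δ, hδ, hgap⟩ := exists_pos_forall_le_abs_sub hz
  refine Integrable.of_bound (by measurability) (1 / δ) ?_
  filter_upwards [ae_restrict_mem measurableSet_Icc] with x hx
  rw [Real.norm_eq_abs, abs_div, abs_one]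
  exact one_div_le_one_div_of_le hδ (hgap x hx)

theorem abs_stieltjes_le [IsProbabilityMeasure ρ] {δ : ℝ} (hδ : 0 < δ)
    (hgap : ∀ x ∈ Icc 0 b, δ ≤ |z - x|) : |stieltjes ρ b z| ≤ 1 / δ := by
  have hbound : ∀ x ∈ Icc 0 b, ‖1 / (z - x)‖ ≤ 1 / δ := fun x hx => by
    rw [Real.norm_eq_abs, abs_div, abs_one]
    exact one_div_le_one_div_of_le hδ (hgap x hx)
  refine (norm_setIntegral_le_of_norm_le_const (measure_lt_top _ _) hbound).trans ?_
  exact mul_le_of_le_one_right (by positivity) measureReal_le_one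

theorem setIntegral_pos_of_forall_pos {α : Type*} [MeasurableSpace α] {μ : Measure α} {s : Set α}
    (hs : MeasurableSet s) (hμs : μ s ≠ 0) {f : α → ℝ} (hf : IntegrableOn f s μ)
    (hpos : ∀ x ∈ s, 0 < f x) : 0 < ∫ x in s, f x ∂μ := by
  rw [setIntegral_pos_iff_support_of_nonneg_ae
    ((ae_restrict_mem hs).mono fun x hx => (hpos x hx).le) hf]
  have hsub : s ⊆ Function.support f := fun x hx => (hpos x hx).ne'
  rwa [inter_eq_right.2 hsub, pos_iff_ne_zero]

variable [IsFiniteMeasure ρ]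

theorem continuousOn_stieltjes : ContinuousOn (stieltjes ρ b) (Icc 0 b)ᶜ := by
  refine fun z hz => ContinuousAt.continuousWithinAt ?_
  obtain ⟨δ, hδ, hgap⟩ := exists_pos_forall_le_abs_sub hz
  refine continuousAt_of_dominated (bound := fun _ => 1 / (δ / 2))
    (.of_forall fun w => by measurability) ?_ (integrable_const _) ?_
  · filter_upwards [Metric.ball_mem_nhds z (half_pos hδ)] with w hw
    filter_upwards [ae_restrict_mem measurableSet_Icc] with x hx
    rw [Real.norm_eq_abs, abs_div, abs_one]
    refine one_div_le_one_div_of_le (half_pos hδ) ?_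
    rw [Metric.mem_ball', Real.dist_eq] at hw
    linarith [hgap x hx, abs_sub_le z w x]
  · filter_upwards [ae_restrict_mem measurableSet_Icc] with x hx
    exact continuousAt_const.div (by fun_prop) (sub_ne_zero_of_notMem_Icc hz hx)

theorem stieltjes_mul_sub_pos (hρ : ρ (Icc 0 b) ≠ 0) (hz : z ∉ Icc 0 b) {x : ℝ}
    (hx : x ∈ Icc 0 b) : 0 < stieltjes ρ b z * (z - x) := by
  rw [stieltjes, ← integral_mul_const]
  refine setIntegral_pos_of_forall_pos measurableSet_Icc hρ
    ((integrableOn_one_div_sub hz).mul_const _) fun y hy => ?_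
  rw [one_div_mul_eq_div]
  rcases lt_or_ge z 0 with hneg | hnonneg
  · exact div_pos_of_neg_of_neg (by linarith [hx.1]) (by linarith [hy.1])
  · have hbz : b < z := not_le.1 fun h => hz ⟨hnonneg, h⟩
    exact div_pos (by linarith [hx.2]) (by linarith [hy.2])

theorem strictAntiOn_stieltjes (hρ : ρ (Icc 0 b) ≠ 0) {s : Set ℝ} [hs : s.OrdConnected]
    (hsub : s ⊆ (Icc 0 b)ᶜ) : StrictAntiOn (stieltjes ρ b) s := by
  intro z hz w hw hzw
  have hzi := integrableOn_one_div_sub (ρ := ρ) (hsub hz)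
  have hwi := integrableOn_one_div_sub (ρ := ρ) (hsub hw)
  rw [← sub_pos, stieltjes, stieltjes, ← integral_sub hzi hwi]
  refine setIntegral_pos_of_forall_pos measurableSet_Icc hρ (hzi.sub hwi) fun x hx => ?_
  have hzx := sub_ne_zero_of_notMem_Icc (hsub hz) hx
  have hwx := sub_ne_zero_of_notMem_Icc (hsub hw) hx
  have hside : 0 < (z - x) * (w - x) := by
    rcases lt_or_ge x z with h | h
    · exact mul_pos (by linarith) (by linarith)
    · have hwx : w < x := not_le.1 fun h' => hsub (hs.out hz hw ⟨h, h'⟩) hx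
      exact mul_pos_of_neg_of_neg (by linarith) (by linarith)
  have hdiff : 1 / (z - x) - 1 / (w - x) = (w - z) / ((z - x) * (w - x)) := by
    field_simp
    ring
  rw [hdiff]
  exact div_pos (sub_pos.2 hzw) hside

end Stieltjes

section StieltjesInverse

variable {b θ : ℝ} {ρ : Measure ℝ}

theorem one_add_mul_limitEnergy_sub (hθ : θ ≠ 0) (x : ℝ) :
    1 + 2 * θ * (limitEnergy ρ b θ - x) = 2 * θ * (stieltjesInv ρ b (2 * θ) - x) := by
  rw [limitEnergy, rTransform]
  field_simp
  ring

theorem Ioi_subset_compl_Icc : Ioi b ⊆ (Icc 0 b)ᶜ := fun _ hz hm => not_lt.2 hm.2 hz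

theorem Iio_subset_compl_Icc : Iio 0 ⊆ (Icc 0 b)ᶜ := fun _ hz hm => not_lt.2 hm.1 hz

variable [IsProbabilityMeasure ρ]

theorem exists_stieltjes_eq_of_pos (hρ : ρ (Icc 0 b) ≠ 0) (hθ : 0 < θ)
    (hmax : ((2 * θ : ℝ) : EReal) < stieltjesMax ρ b) :
    ∃ z ∈ (Icc 0 b)ᶜ, stieltjes ρ b z = 2 * θ := by
  have hanti : AntitoneOn (fun z => (stieltjes ρ b z : EReal)) (Ioi b) := fun z hz w hw hzw =>
    EReal.coe_le_coe_iff.2 <|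
      (strictAntiOn_stieltjes hρ Ioi_subset_compl_Icc).antitoneOn hz hw hzw
  rw [stieltjesMax, (hanti.tendsto_nhdsGT (OrderTop.bddAbove _)).limUnder_eq, lt_sSup_iff] at hmax
  obtain ⟨_, ⟨z₁, hz₁, rfl⟩, hlt⟩ := hmax
  have hlt : 2 * θ < stieltjes ρ b z₁ := EReal.coe_lt_coe_iff.1 hlt
  have hinv : 0 < 1 / θ := one_div_pos.2 hθ
  have hle : |stieltjes ρ b (b + 1 / θ)| ≤ 1 / (1 / θ) := abs_stieltjes_le hinv fun x hx => by
    rw [abs_of_nonneg (by linarith [hx.2])]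
    linarith [hx.2]
  rw [one_div_one_div] at hle
  obtain ⟨z, hz, heq⟩ := isPreconnected_Ioi.intermediate_value
    (mem_Ioi.2 (lt_add_of_pos_right b hinv)) hz₁
    (continuousOn_stieltjes.mono Ioi_subset_compl_Icc) ⟨by linarith [abs_le.1 hle], hlt.le⟩
  exact ⟨z, Ioi_subset_compl_Icc hz, heq⟩

theorem exists_stieltjes_eq_of_neg (hρ : ρ (Icc 0 b) ≠ 0) (hθ : θ < 0)
    (hmin : stieltjesMin ρ b < ((2 * θ : ℝ) : EReal)) :
    ∃ z ∈ (Icc 0 b)ᶜ, stieltjes ρ b z = 2 * θ := by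
  have hanti : AntitoneOn (fun z => (stieltjes ρ b z : EReal)) (Iio 0) := fun z hz w hw hzw =>
    EReal.coe_le_coe_iff.2 <|
      (strictAntiOn_stieltjes hρ Iio_subset_compl_Icc).antitoneOn hz hw hzw
  rw [stieltjesMin, (hanti.tendsto_nhdsLT (OrderBot.bddBelow _)).limUnder_eq, sInf_lt_iff] at hmin
  obtain ⟨_, ⟨z₁, hz₁, rfl⟩, hlt⟩ := hmin
  have hlt : stieltjes ρ b z₁ < 2 * θ := EReal.coe_lt_coe_iff.1 hlt
  have hinv : 1 / θ < 0 := one_div_neg.2 hθ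
  have hle : |stieltjes ρ b (1 / θ)| ≤ 1 / -(1 / θ) :=
    abs_stieltjes_le (neg_pos.2 hinv) fun x hx => by
      rw [abs_of_nonpos (by linarith [hx.1])]
      linarith [hx.1]
  rw [one_div_neg_eq_neg_one_div, one_div_one_div] at hle
  obtain ⟨z, hz, heq⟩ := isPreconnected_Iio.intermediate_value hz₁ (mem_Iio.2 hinv)
    (continuousOn_stieltjes.mono Iio_subset_compl_Icc) ⟨hlt.le, by linarith [abs_le.1 hle]⟩
  exact ⟨z, Iio_subset_compl_Icc hz, heq⟩

theorem exists_stieltjes_eq (hρ : ρ (Icc 0 b) ≠ 0) (hθ : θ ∈ highTemp ρ b) :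
    ∃ z ∈ (Icc 0 b)ᶜ, stieltjes ρ b z = 2 * θ := by
  obtain ⟨hmin, hmax, hne⟩ := hθ
  rcases lt_or_gt_of_ne hne with hneg | hpos
  · exact exists_stieltjes_eq_of_neg hρ hneg hmin
  · exact exists_stieltjes_eq_of_pos hρ hpos hmax

theorem stieltjesInv_notMem (hρ : ρ (Icc 0 b) ≠ 0) (hθ : θ ∈ highTemp ρ b) :
    stieltjesInv ρ b (2 * θ) ∉ Icc 0 b :=
  Function.invFunOn_mem (exists_stieltjes_eq hρ hθ)

theorem stieltjes_stieltjesInv (hρ : ρ (Icc 0 b) ≠ 0) (hθ : θ ∈ highTemp ρ b) :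
    stieltjes ρ b (stieltjesInv ρ b (2 * θ)) = 2 * θ :=
  Function.invFunOn_eq (exists_stieltjes_eq hρ hθ)

theorem one_add_mul_limitEnergy_sub_pos (hρ : ρ (Icc 0 b) ≠ 0) (hθ : θ ∈ highTemp ρ b) {x : ℝ}
    (hx : x ∈ Icc 0 b) : 0 < 1 + 2 * θ * (limitEnergy ρ b θ - x) := by
  have hpos := stieltjes_mul_sub_pos hρ (stieltjesInv_notMem hρ hθ) hx
  rwa [stieltjes_stieltjesInv hρ hθ, ← one_add_mul_limitEnergy_sub hθ.2.2] at hpos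

end StieltjesInverse

section StieltjesConvergence

variable {ι : Type*} {l : Filter ι} {μ : ι → Measure ℝ} {ρ : Measure ℝ} {b z : ℝ}

theorem lipschitzWith_one_div_sub {α : Type*} [PseudoMetricSpace α] {f : α → ℝ}
    (hf : LipschitzWith 1 f) {δ : ℝ} (hδ : 0 < δ) (hgap : ∀ x, δ ≤ |z - f x|) :
    LipschitzWith (Real.toNNReal (1 / δ * (1 / δ))) fun x => 1 / (z - f x) := by
  have hne (x : α) : z - f x ≠ 0 := abs_pos.1 (hδ.trans_le (hgap x))
  have hbound (x : α) : |1 / (z - f x)| ≤ 1 / δ := by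
    rw [abs_div, abs_one]
    exact one_div_le_one_div_of_le hδ (hgap x)
  refine LipschitzWith.of_dist_le_mul fun x y => ?_
  have hdiff : 1 / (z - f x) - 1 / (z - f y) = 1 / (z - f x) * (1 / (z - f y)) * (f x - f y) := by
    have hx := hne x
    have hy := hne y
    field_simp
    ring
  rw [Real.coe_toNNReal _ (by positivity), Real.dist_eq, hdiff, abs_mul, abs_mul, ← Real.dist_eq]
  gcongr
  · exact hbound x
  · exact hbound y
  · simpa only [NNReal.coe_one, one_mul] using hf.dist_le_mul x y

theorem tendsto_stieltjes_of_tendsto_wasserstein1 [l.NeBot] [IsFiniteMeasure ρ] (hb : 0 ≤ b)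
    (hμ : ∀ᶠ n in l, IsProbabilityMeasure (μ n)) (hμb : ∀ᶠ n in l, ∀ᵐ x ∂(μ n), x ∈ Icc 0 b)
    (hρ : Tendsto (fun n => wasserstein1 (μ n) ρ) l (𝓝 0)) (hz : z ∉ Icc 0 b) :
    Tendsto (fun n => stieltjes (μ n) b z) l (𝓝 (stieltjes ρ b z)) := by
  obtain ⟨δ, hδ, hgap⟩ := exists_pos_forall_le_abs_sub hz
  have hgap' (x : ℝ) : δ ≤ |z - projIcc 0 b hb x| := hgap _ (projIcc 0 b hb x).2
  have hlip := lipschitzWith_one_div_sub (LipschitzWith.projIcc hb) hδ hgap'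
  have hbound (x : ℝ) : |1 / (z - projIcc 0 b hb x)| ≤ 1 / δ := by
    rw [abs_div, abs_one]
    exact one_div_le_one_div_of_le hδ (hgap' x)
  have hstieltjes {ν : Measure ℝ} (hν : ∀ᵐ x ∂ν, x ∈ Icc 0 b) :
      ∫ x, 1 / (z - projIcc 0 b hb x) ∂ν = stieltjes ν b z := by
    rw [stieltjes, Measure.restrict_eq_self_of_ae_mem hν]
    exact integral_congr_ae (hν.mono fun x hx => by simp only [projIcc_of_mem hb hx])
  have hρb := ae_mem_of_tendsto_wasserstein1 hμ hρ isClosed_Icc (nonempty_Icc.2 hb) hμb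
  rw [← hstieltjes hρb]
  exact (tendsto_integral_of_tendsto_wasserstein1 hμ hρ hlip hbound).congr'
    (hμb.mono fun n hn => hstieltjes hn)

theorem eventually_exists_stieltjes_eq [IsFiniteMeasure ρ] (hρb : ρ (Icc 0 b) ≠ 0)
    (hμ : ∀ᶠ n in l, IsProbabilityMeasure (μ n))
    (hlim : ∀ z ∉ Icc 0 b, Tendsto (fun n => stieltjes (μ n) b z) l (𝓝 (stieltjes ρ b z)))
    (hz : z ∉ Icc 0 b) {ε : ℝ} (hε : 0 < ε) :
    ∀ᶠ n in l, ∃ κ, |κ - z| < ε ∧ stieltjes (μ n) b κ = stieltjes ρ b z := by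
  obtain ⟨δ, hδ, hball⟩ := Metric.nhds_basis_closedBall.mem_iff.1
    (Filter.inter_mem (isClosed_Icc.isOpen_compl.mem_nhds hz) (Metric.ball_mem_nhds z hε))
  rw [Real.closedBall_eq_Icc] at hball
  have hsub : Icc (z - δ) (z + δ) ⊆ (Icc 0 b)ᶜ := fun w hw => (hball hw).1
  have hleft : z - δ ∈ Icc (z - δ) (z + δ) := ⟨le_rfl, by linarith⟩
  have hright : z + δ ∈ Icc (z - δ) (z + δ) := ⟨by linarith, le_rfl⟩
  have hmid : z ∈ Icc (z - δ) (z + δ) := ⟨by linarith, by linarith⟩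
  have hanti := strictAntiOn_stieltjes hρb hsub
  filter_upwards [hμ,
    (hlim _ (hsub hleft)).eventually_const_lt (hanti hleft hmid (by linarith)),
    (hlim _ (hsub hright)).eventually_lt_const (hanti hmid hright (by linarith))]
    with n _ hlow hhigh
  obtain ⟨κ, hκ, heq⟩ := isPreconnected_Icc.intermediate_value hright hleft
    (continuousOn_stieltjes.mono hsub) ⟨hhigh.le, hlow.le⟩
  exact ⟨κ, by simpa [Real.dist_eq] using (hball hκ).2, heq⟩

end StieltjesConvergence

section Homogeneous

variable {E β : Type*} [NormedAddCommGroup E] [NormedSpace ℝ E] [FiniteDimensional ℝ E]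
  [MeasurableSpace E] [BorelSpace E] {mβ : MeasurableSpace β} {μ : Measure E} [μ.IsAddHaarMeasure]
  {s : E → ℝ} {D : Set E}

theorem measure_inter_le_one_eq_of_homogeneous (hhom : ∀ t > 0, ∀ x, s (t • x) = t * s x)
    (hD : ∀ t > (0 : ℝ), ∀ x, t • x ∈ D ↔ x ∈ D) {t : ℝ} (ht : 0 < t) :
    μ (D ∩ {x | s x ≤ 1}) =
      ENNReal.ofReal |(t ^ Module.finrank ℝ E)⁻¹| * μ (D ∩ {x | s x ≤ t}) := by
  rw [← Measure.addHaar_preimage_smul μ ht.ne']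
  congr 1
  ext x
  simp [hD t ht, hhom t ht, mul_le_iff_le_one_right ht]

theorem measure_le_one_ne_zero_of_homogeneous (hhom : ∀ t > 0, ∀ x, s (t • x) = t * s x) :
    μ {x | s x ≤ 1} ≠ 0 := by
  intro hzero
  have hnull (n : ℕ) : μ {x | s x ≤ n + 1} = 0 := by
    have h := measure_inter_le_one_eq_of_homogeneous (μ := μ) (D := univ) hhom (by simp)
      (n.cast_add_one_pos (α := ℝ))
    rw [univ_inter, univ_inter, hzero, eq_comm, mul_eq_zero, ENNReal.ofReal_eq_zero] at h
    exact h.resolve_left (not_le.2 (by positivity))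
  have hcover : ⋃ n : ℕ, {x | s x ≤ n + 1} = univ := eq_univ_of_forall fun x => by
    obtain ⟨n, hn⟩ := exists_nat_ge (s x)
    exact mem_iUnion.2 ⟨n, hn.trans (by linarith)⟩
  exact NeZero.ne μ (Measure.measure_univ_eq_zero.1 (hcover ▸ measure_iUnion_null hnull))

/-- The law of `s` restricted to a cone is determined by the mass of one sublevel set, since both
sides scale in the same way. -/
theorem smul_map_restrict_eq_smul_map_of_homogeneous (hs : Measurable s) (hpos : ∀ᵐ x ∂μ, 0 < s x)
    (hhom : ∀ t > 0, ∀ x, s (t • x) = t * s x) (hfin : μ {x | s x ≤ 1} ≠ ∞)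
    (hD : ∀ t > (0 : ℝ), ∀ x, t • x ∈ D ↔ x ∈ D) :
    μ {x | s x ≤ 1} • (μ.restrict D).map s = μ (D ∩ {x | s x ≤ 1}) • μ.map s := by
  have hscale {t : ℝ} (ht : 0 < t) :=
    measure_inter_le_one_eq_of_homogeneous (μ := μ) (D := univ) hhom (by simp) ht
  simp only [univ_inter] at hscale
  have happly (t : ℝ) : (μ {x | s x ≤ 1} • (μ.restrict D).map s) (Iic t) =
      μ {x | s x ≤ 1} * μ (D ∩ {x | s x ≤ t}) := by
    rw [Measure.smul_apply, Measure.map_apply hs measurableSet_Iic,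
      Measure.restrict_apply (hs measurableSet_Iic), inter_comm]
    rfl
  refine Measure.ext_of_generateFrom_of_iUnion (range Iic) (fun n : ℕ => Iic (n + 1 : ℝ))
    (borel_eq_generateFrom_Iic ℝ ▸ BorelSpace.measurable_eq) isPiSystem_Iic ?_
    (fun n => mem_range_self _) (fun n => ?_) ?_
  · refine eq_univ_of_forall fun x => ?_
    obtain ⟨n, hn⟩ := exists_nat_ge x
    exact mem_iUnion.2 ⟨n, hn.trans (by linarith)⟩
  · have hn : μ {x | s x ≤ n + 1} ≠ ∞ := fun htop => hfin <| by
      rw [hscale n.cast_add_one_pos, htop, ENNReal.mul_top]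
      have := n.cast_add_one_pos (α := ℝ)
      positivity
    rw [happly]
    exact ENNReal.mul_ne_top hfin (measure_ne_top_of_subset inter_subset_right hn)
  · rintro _ ⟨t, rfl⟩
    rw [happly, Measure.smul_apply, Measure.map_apply hs measurableSet_Iic, smul_eq_mul]
    change _ = _ * μ {x | s x ≤ t}
    rcases le_or_gt t 0 with ht | ht
    · have hnull : μ {x | s x ≤ t} = 0 :=
        measure_mono_null (fun x hx => not_lt.2 (le_trans hx ht)) hpos
      rw [hnull, measure_mono_null inter_subset_right hnull, mul_zero, mul_zero]
    · rw [hscale ht, measure_inter_le_one_eq_of_homogeneous hhom hD ht]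
      ring

theorem indepFun_withDensity_comp_of_homogeneous (hs : Measurable s) (hpos : ∀ᵐ x ∂μ, 0 < s x)
    (hhom : ∀ t > 0, ∀ x, s (t • x) = t * s x) (hfin : μ {x | s x ≤ 1} ≠ ∞)
    {A : E → β} (hA : Measurable A) (hA₀ : ∀ t > (0 : ℝ), ∀ x, A (t • x) = A x)
    {φ : ℝ → ℝ≥0∞} (hφ : Measurable φ) [IsProbabilityMeasure (μ.withDensity (φ ∘ s))] :
    IndepFun A s (μ.withDensity (φ ∘ s)) := by
  rw [indepFun_iff_measure_inter_preimage_eq_mul]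
  intro T B hT hB
  set P := μ.withDensity (φ ∘ s)
  have hlaw {D : Set E} (hDm : MeasurableSet D) {B : Set ℝ} (hB : MeasurableSet B) :
      P (D ∩ s ⁻¹' B) = ∫⁻ r in B, φ r ∂(μ.restrict D).map s := by
    rw [withDensity_apply _ (hDm.inter (hs hB)), setLIntegral_map hB hφ hs,
      Measure.restrict_restrict (hs hB), inter_comm]
    rfl
  have hcone {B : Set ℝ} (hB : MeasurableSet B) :
      μ {x | s x ≤ 1} * P (A ⁻¹' T ∩ s ⁻¹' B) = μ (A ⁻¹' T ∩ {x | s x ≤ 1}) * P (s ⁻¹' B) := by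
    have hmap := smul_map_restrict_eq_smul_map_of_homogeneous (D := A ⁻¹' T) hs hpos hhom hfin
      fun t ht x => by rw [mem_preimage, mem_preimage, hA₀ t ht]
    have huniv := hlaw .univ hB
    rw [univ_inter, Measure.restrict_univ] at huniv
    rw [hlaw (hA hT) hB, huniv, ← smul_eq_mul, ← lintegral_smul_measure, ← Measure.restrict_smul,
      hmap, Measure.restrict_smul, lintegral_smul_measure, smul_eq_mul]
  have htotal := hcone .univ
  rw [preimage_univ, inter_univ, measure_univ, mul_one] at htotal
  refine (ENNReal.mul_right_inj (measure_le_one_ne_zero_of_homogeneous hhom) hfin).1 ?_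
  rw [hcone hB, ← htotal, mul_assoc]

end Homogeneous

section Tilted

theorem integrable_exp_of_neZero_tilted {α : Type*} {mα : MeasurableSpace α} {μ : Measure α}
    {f : α → ℝ} [NeZero (μ.tilted f)] : Integrable (fun x => Real.exp (f x)) μ := by
  by_contra hf
  exact NeZero.ne (μ.tilted f) (tilted_of_not_integrable hf)

theorem prod_tilted {α β : Type*} {mα : MeasurableSpace α} {mβ : MeasurableSpace β}
    {μ : Measure α} {ν : Measure β} [SigmaFinite μ] [SigmaFinite ν] {u : α → ℝ} {w : β → ℝ}
    (hu : Measurable u) (hw : Measurable w) :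
    (μ.tilted u).prod (ν.tilted w) = (μ.prod ν).tilted fun p => u p.1 + w p.2 := by
  have hexp : ∫ p : α × β, Real.exp (u p.1 + w p.2) ∂(μ.prod ν) =
      (∫ x, Real.exp (u x) ∂μ) * ∫ y, Real.exp (w y) ∂ν := by
    simp only [Real.exp_add]
    exact integral_prod_mul (fun x => Real.exp (u x)) fun y => Real.exp (w y)
  unfold Measure.tilted
  rw [prod_withDensity (by fun_prop) (by fun_prop)]
  congr 1 with p
  rw [← ENNReal.ofReal_mul (by positivity), hexp, Real.exp_add, div_mul_div_comm]

theorem pi_tilted {ι : Type*} [Fintype ι] {α : ι → Type*} [∀ i, MeasurableSpace (α i)]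
    (μ : ∀ i, Measure (α i)) [∀ i, SigmaFinite (μ i)] (f : ∀ i, α i → ℝ) :
    Measure.pi (fun i => (μ i).tilted (f i)) =
      (Measure.pi μ).tilted fun x => ∑ i, f i (x i) := by
  refine Measure.pi_eq fun s hs => ?_
  have hexp : ∫ x, Real.exp (∑ i, f i (x i)) ∂Measure.pi μ =
      ∏ i, ∫ y, Real.exp (f i y) ∂(μ i) := by
    simp only [Real.exp_sum]
    exact integral_fintype_prod_eq_prod fun i y => Real.exp (f i y)
  rw [tilted_apply_eq_ofReal_integral' _ (MeasurableSet.univ_pi hs), Measure.restrict_pi_pi, hexp]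
  simp only [Real.exp_sum, ← Finset.prod_div_distrib]
  rw [integral_fintype_prod_eq_prod fun i y => Real.exp (f i y) / ∫ y, Real.exp (f i y) ∂(μ i),
    ENNReal.ofReal_prod_of_nonneg fun i _ => by positivity]
  exact Finset.prod_congr rfl fun i _ => (tilted_apply_eq_ofReal_integral' _ (hs i)).symm

end Tilted

section GaussianPi

variable {ι : Type*} [Fintype ι] {l : ι → ℝ} {g : ι → ℝ}

/-- The law of independent centred Gaussians with variances `1 / l i`. The precisions `l i` are
meant to be positive; a nonpositive `l i` gives a Dirac mass at `0` in that coordinate. -/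
noncomputable def gaussianPi (l : ι → ℝ) : Measure (ι → ℝ) :=
  Measure.pi fun i => gaussianReal 0 (Real.toNNReal (1 / l i))

instance isProbabilityMeasure_gaussianPi (l : ι → ℝ) : IsProbabilityMeasure (gaussianPi l) := by
  unfold gaussianPi
  infer_instance

theorem stdNormal_eq_gaussianPi (N : ℕ) : stdNormal N = gaussianPi fun _ => 1 := by
  simp [stdNormal, gaussianPi]

/-- The diagonal quadratic form `∑ i, l i * g i ^ 2`; in particular `quad (fun _ => 1) g` is the
squared Euclidean norm of `g`. -/
noncomputable def quad (l g : ι → ℝ) : ℝ := ∑ i, l i * g i ^ 2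

@[fun_prop]
theorem measurable_quad (l : ι → ℝ) : Measurable (quad l) := by
  unfold quad
  fun_prop

theorem quad_smul (l : ι → ℝ) (t : ℝ) (g : ι → ℝ) : quad l (t • g) = t ^ 2 * quad l g := by
  simp only [quad, Pi.smul_apply, smul_eq_mul, Finset.mul_sum]
  exact Finset.sum_congr rfl fun i _ => by ring

theorem quad_nonneg (hl : ∀ i, 0 ≤ l i) (g : ι → ℝ) : 0 ≤ quad l g :=
  Finset.sum_nonneg fun i _ => mul_nonneg (hl i) (sq_nonneg _)

theorem quad_pos (hl : ∀ i, 0 < l i) (hg : g ≠ 0) : 0 < quad l g := by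
  obtain ⟨i, hi⟩ := Function.ne_iff.1 hg
  exact Finset.sum_pos' (fun j _ => mul_nonneg (hl j).le (sq_nonneg _))
    ⟨i, Finset.mem_univ _, mul_pos (hl i) (sq_pos_of_ne_zero hi)⟩

theorem gaussianReal_eq_tilted {a : ℝ} (ha : 0 < a) :
    gaussianReal 0 (Real.toNNReal (1 / a)) =
      (volume : Measure ℝ).tilted fun x => -(a * x ^ 2) / 2 := by
  have hexp : ∫ x : ℝ, Real.exp (-(a * x ^ 2) / 2) = √(2 * Real.pi * (1 / a)) := by
    have heq (x : ℝ) : -(a * x ^ 2) / 2 = -(a / 2) * x ^ 2 := by ring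
    simp only [heq, integral_gaussian]
    congr 1
    field_simp
  rw [gaussianReal_of_var_ne_zero _ (by simpa using ha), Measure.tilted]
  congr 1 with x
  rw [gaussianPDF, gaussianPDFReal, hexp, Real.coe_toNNReal _ (by positivity), sub_zero,
    inv_mul_eq_div]
  congr 3
  field_simp

theorem gaussianPi_eq_tilted_volume (hl : ∀ i, 0 < l i) :
    gaussianPi l = (volume : Measure (ι → ℝ)).tilted fun g => -quad l g / 2 := by
  have hpi := pi_tilted (fun _ : ι => (volume : Measure ℝ)) fun i x => -(l i * x ^ 2) / 2
  simp only [← gaussianReal_eq_tilted (hl _)] at hpi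
  rw [gaussianPi, hpi, volume_pi]
  congr 1 with g
  rw [quad, neg_div, Finset.sum_div, ← Finset.sum_neg_distrib]
  exact Finset.sum_congr rfl fun i _ => neg_div _ _

theorem integrable_exp_neg_quad (hl : ∀ i, 0 < l i) :
    Integrable fun g : ι → ℝ => Real.exp (-quad l g / 2) := by
  have : NeZero ((volume : Measure (ι → ℝ)).tilted fun g => -quad l g / 2) :=
    gaussianPi_eq_tilted_volume hl ▸ inferInstance
  exact integrable_exp_of_neZero_tilted

theorem gaussianPi_tilted {l' : ι → ℝ} (hl : ∀ i, 0 < l i) (hl' : ∀ i, 0 < l' i) :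
    (gaussianPi l).tilted (fun g => (quad l g - quad l' g) / 2) = gaussianPi l' := by
  rw [gaussianPi_eq_tilted_volume hl, gaussianPi_eq_tilted_volume hl',
    tilted_tilted (integrable_exp_neg_quad hl)]
  congr 1 with g
  simp only [Pi.add_apply]
  ring

theorem integrable_exp_quad_sub {l' : ι → ℝ} (hl : ∀ i, 0 < l i) (hl' : ∀ i, 0 < l' i) :
    Integrable (fun g => Real.exp ((quad l g - quad l' g) / 2)) (gaussianPi l) := by
  have : NeZero ((gaussianPi l).tilted fun g => (quad l g - quad l' g) / 2) :=
    gaussianPi_tilted hl hl' ▸ inferInstance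
  exact integrable_exp_of_neZero_tilted

theorem ae_ne_zero_gaussianPi [Nonempty ι] (hl : ∀ i, 0 < l i) : ∀ᵐ g ∂(gaussianPi l), g ≠ 0 := by
  rw [gaussianPi_eq_tilted_volume hl]
  exact (tilted_absolutelyContinuous _ _).ae_le (compl_mem_ae_iff.2 (measure_singleton 0))

theorem indepFun_quad_gaussianPi [Nonempty ι] (hl : ∀ i, 0 < l i) {β : Type*}
    {mβ : MeasurableSpace β} {A : (ι → ℝ) → β} (hA : Measurable A)
    (hA₀ : ∀ t > (0 : ℝ), ∀ g, A (t • g) = A g) :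
    IndepFun A (quad l) (gaussianPi l) := by
  have hnonneg := quad_nonneg fun i => (hl i).le
  set Z := ∫ g, Real.exp (-quad l g / 2)
  have hdensity : gaussianPi l = (volume : Measure (ι → ℝ)).withDensity
      ((fun r => ENNReal.ofReal (Real.exp (-r ^ 2 / 2) / Z)) ∘ fun g => √(quad l g)) := by
    rw [gaussianPi_eq_tilted_volume hl, Measure.tilted]
    congr 1 with g
    simp only [Function.comp_apply, Real.sq_sqrt (hnonneg g), Z]
  have hhom (t : ℝ) (ht : t > 0) (g : ι → ℝ) : √(quad l (t • g)) = t * √(quad l g) := by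
    rw [quad_smul, Real.sqrt_mul (sq_nonneg t), Real.sqrt_sq ht.le]
  have hpos : ∀ᵐ g : ι → ℝ, 0 < √(quad l g) := by
    filter_upwards [compl_mem_ae_iff.2 (measure_singleton 0)] with g hg
    exact Real.sqrt_pos.2 (quad_pos hl hg)
  have hfin : volume {g | √(quad l g) ≤ 1} ≠ ∞ := by
    refine measure_ne_top_of_subset (fun g hg => ?_)
      ((integrable_exp_neg_quad hl).measure_ge_lt_top (Real.exp_pos (-1 / 2))).ne
    have : quad l g ≤ 1 := Real.sqrt_le_one.1 hg
    exact Real.exp_le_exp.2 (by linarith)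
  have : IsProbabilityMeasure ((volume : Measure (ι → ℝ)).withDensity
      ((fun r => ENNReal.ofReal (Real.exp (-r ^ 2 / 2) / Z)) ∘ fun g => √(quad l g))) :=
    hdensity ▸ inferInstance
  have hind := indepFun_withDensity_comp_of_homogeneous (by fun_prop) hpos hhom hfin hA hA₀
    (φ := fun r => ENNReal.ofReal (Real.exp (-r ^ 2 / 2) / Z)) (by fun_prop)
  rw [← hdensity] at hind
  have hsq : (fun r => r ^ 2) ∘ (fun g => √(quad l g)) = quad l :=
    funext fun g => Real.sq_sqrt (hnonneg g)
  exact hsq ▸ hind.comp measurable_id (measurable_id.pow_const 2)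

end GaussianPi

section Moments

theorem integrable_pow_gaussianReal (n : ℕ) (v : ℝ≥0) :
    Integrable (fun x : ℝ => x ^ n) (gaussianReal 0 v) := by
  have h := (memLp_id_gaussianReal (μ := 0) (v := v) (n : ℝ≥0)).integrable_norm_pow'
  refine (integrable_norm_iff (by fun_prop)).1 ?_
  simpa [norm_pow] using h

theorem integral_sq_gaussianReal (v : ℝ≥0) : ∫ x, x ^ 2 ∂(gaussianReal 0 v) = v := by
  have h := variance_fun_id_gaussianReal (μ := 0) (v := v)
  rwa [variance_of_integral_eq_zero (by fun_prop) integral_id_gaussianReal] at h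

/-- The fourth moment of the standard normal law; its value `3` is never needed. -/
noncomputable def normalFourthMoment : ℝ := ∫ x, x ^ 4 ∂(gaussianReal 0 1)

theorem normalFourthMoment_nonneg : 0 ≤ normalFourthMoment :=
  integral_nonneg fun x => by positivity

theorem gaussianReal_eq_map (v : ℝ≥0) :
    gaussianReal 0 v = (gaussianReal 0 1).map fun x => √(v : ℝ) * x := by
  have hvar : NNReal.mk (√(v : ℝ) ^ 2) (sq_nonneg _) * 1 = v := by
    ext
    simp
  rw [gaussianReal_map_const_mul, mul_zero, hvar]

theorem integral_pow_four_gaussianReal (v : ℝ≥0) :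
    ∫ x, x ^ 4 ∂(gaussianReal 0 v) = (v : ℝ) ^ 2 * normalFourthMoment := by
  have hsqrt : √(v : ℝ) ^ 4 = (v : ℝ) ^ 2 := by
    rw [show 4 = 2 * 2 from rfl, pow_mul, Real.sq_sqrt v.coe_nonneg]
  rw [gaussianReal_eq_map, integral_map (by fun_prop) (by fun_prop), normalFourthMoment,
    ← integral_const_mul]
  simp only [mul_pow, hsqrt]

theorem memLp_const_mul_sq_gaussianReal (a : ℝ) (v : ℝ≥0) :
    MemLp (fun x : ℝ => a * x ^ 2) 2 (gaussianReal 0 v) := by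
  refine (memLp_two_iff_integrable_sq (by fun_prop)).2 ?_
  simpa only [mul_pow, ← pow_mul] using (integrable_pow_gaussianReal 4 v).const_mul (a ^ 2)

variable {ι : Type*} [Fintype ι] {l : ι → ℝ}

theorem integrable_pow_gaussianPi (l : ι → ℝ) (n : ℕ) (i : ι) :
    Integrable (fun g : ι → ℝ => g i ^ n) (gaussianPi l) :=
  integrable_comp_eval (μ := fun i => gaussianReal 0 (Real.toNNReal (1 / l i)))
    (f := fun x : ℝ => x ^ n) (integrable_pow_gaussianReal n _)

theorem integral_pow_gaussianPi (l : ι → ℝ) (n : ℕ) (i : ι) :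
    ∫ g, g i ^ n ∂(gaussianPi l) = ∫ x, x ^ n ∂(gaussianReal 0 (Real.toNNReal (1 / l i))) :=
  integral_comp_eval (μ := fun i => gaussianReal 0 (Real.toNNReal (1 / l i)))
    (f := fun x : ℝ => x ^ n) (by fun_prop)

theorem integral_pow_four_gaussianPi (hl : ∀ i, 0 < l i) (i : ι) :
    ∫ g, g i ^ 4 ∂(gaussianPi l) = normalFourthMoment / l i ^ 2 := by
  rw [integral_pow_gaussianPi, integral_pow_four_gaussianReal,
    Real.coe_toNNReal _ (one_div_pos.2 (hl i)).le]
  ring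

theorem memLp_quad_gaussianPi (l a : ι → ℝ) : MemLp (quad a) 2 (gaussianPi l) :=
  memLp_finsetSum _ fun i _ =>
    (memLp_const_mul_sq_gaussianReal (a i) _).comp_measurePreserving
      (measurePreserving_eval (fun i => gaussianReal 0 (Real.toNNReal (1 / l i))) i)

theorem integrable_quad_gaussianPi (l a : ι → ℝ) : Integrable (quad a) (gaussianPi l) :=
  (memLp_quad_gaussianPi l a).integrable one_le_two

theorem integral_quad_gaussianPi (hl : ∀ i, 0 < l i) (a : ι → ℝ) :
    ∫ g, quad a g ∂(gaussianPi l) = ∑ i, a i / l i := by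
  simp only [quad]
  rw [integral_finsetSum _ fun i _ => (integrable_pow_gaussianPi l 2 i).const_mul (a i)]
  refine Finset.sum_congr rfl fun i _ => ?_
  rw [integral_const_mul, integral_pow_gaussianPi, integral_sq_gaussianReal,
    Real.coe_toNNReal _ (one_div_pos.2 (hl i)).le, mul_one_div]

theorem integral_quad_one_gaussianPi :
    ∫ g, quad (fun _ => 1) g ∂(gaussianPi fun _ : ι => 1) = Fintype.card ι := by
  simp [integral_quad_gaussianPi]

theorem variance_quad_gaussianPi_le (hl : ∀ i, 0 < l i) (a : ι → ℝ) :
    Var[quad a; gaussianPi l] ≤ normalFourthMoment * ∑ i, (a i / l i) ^ 2 := by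
  have hsum : quad a = ∑ i, fun g : ι → ℝ => a i * g i ^ 2 := by
    funext g
    simp [quad]
  rw [hsum, gaussianPi, variance_sum_pi (X := fun i x => a i * x ^ 2)
    fun i => memLp_const_mul_sq_gaussianReal (a i) _, Finset.mul_sum]
  refine Finset.sum_le_sum fun i _ => (variance_le_expectation_sq (by fun_prop)).trans_eq ?_
  simp only [Pi.pow_apply, mul_pow, ← pow_mul]
  rw [integral_const_mul, integral_pow_four_gaussianReal,
    Real.coe_toNNReal _ (one_div_pos.2 (hl i)).le]
  ring

theorem sq_sum_div_le_integral_sq_quad_gaussianPi (hl : ∀ i, 0 < l i) (a : ι → ℝ) :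
    (∑ i, a i / l i) ^ 2 ≤ ∫ g, quad a g ^ 2 ∂(gaussianPi l) := by
  have hvar := variance_nonneg (quad a) (gaussianPi l)
  rw [variance_eq_sub (memLp_quad_gaussianPi l a), integral_quad_gaussianPi hl] at hvar
  exact sub_nonneg.1 hvar

theorem variance_quad_one_gaussianPi_le :
    Var[quad fun _ => 1; gaussianPi fun _ : ι => 1] ≤ normalFourthMoment * Fintype.card ι := by
  simpa using variance_quad_gaussianPi_le (ι := ι) (fun _ => one_pos) fun _ => 1

end Moments

section BoundedTilt

variable {Ω : Type*} {mΩ : MeasurableSpace Ω} {μ : Measure Ω} {u f : Ω → ℝ}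

theorem integrable_exp_of_bounded [IsFiniteMeasure μ] (hu : Measurable u) {B : ℝ}
    (hB : ∀ x, u x ≤ B) : Integrable (fun x => Real.exp (u x)) μ :=
  Integrable.of_bound (by fun_prop) (Real.exp B) (ae_of_all _ fun x => by
    rw [Real.norm_eq_abs, Real.abs_exp]
    exact Real.exp_le_exp.2 (hB x))

theorem integrable_tilted_of_bounded [IsFiniteMeasure μ] (hu : Measurable u) {B : ℝ}
    (hB : ∀ x, u x ≤ B) (hf : Integrable f μ) : Integrable f (μ.tilted u) := by
  rw [integrable_tilted_iff (integrable_exp_of_bounded hu hB)]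
  refine hf.bdd_mul (c := Real.exp B) (by fun_prop) (ae_of_all _ fun x => ?_)
  rw [Real.norm_eq_abs, Real.abs_exp]
  exact Real.exp_le_exp.2 (hB x)

theorem integral_tilted_eq_div (μ : Measure Ω) (u f : Ω → ℝ) :
    ∫ x, f x ∂(μ.tilted u) = (∫ x, f x * Real.exp (u x) ∂μ) / ∫ x, Real.exp (u x) ∂μ := by
  rw [integral_tilted, ← integral_div]
  refine integral_congr_ae (ae_of_all _ fun x => ?_)
  simp only [smul_eq_mul]
  ring

theorem tilted_add_const (μ : Measure Ω) (u : Ω → ℝ) (c : ℝ) :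
    μ.tilted (fun x => u x + c) = μ.tilted u := by
  simp only [Measure.tilted, Real.exp_add, integral_mul_const,
    mul_div_mul_right _ _ (Real.exp_pos c).ne']

end BoundedTilt

section Rayleigh

variable {ι : Type*} [Fintype ι] {l g : ι → ℝ}

/-- The Rayleigh quotient `(∑ i, l i * g i ^ 2) / ∑ i, g i ^ 2`; it is `0` at `g = 0`. -/
noncomputable def rayleigh (l g : ι → ℝ) : ℝ := quad l g / quad (fun _ => 1) g

@[fun_prop]
theorem measurable_rayleigh (l : ι → ℝ) : Measurable (rayleigh l) := by
  unfold rayleigh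
  fun_prop

theorem quad_div_quad_smul (l l' : ι → ℝ) {t : ℝ} (ht : 0 < t) (g : ι → ℝ) :
    quad l (t • g) / quad l' (t • g) = quad l g / quad l' g := by
  rw [quad_smul, quad_smul, mul_div_mul_left _ _ (pow_pos ht 2).ne']

theorem rayleigh_smul (l : ι → ℝ) {t : ℝ} (ht : 0 < t) (g : ι → ℝ) :
    rayleigh l (t • g) = rayleigh l g :=
  quad_div_quad_smul l _ ht g

theorem quad_mono {l' : ι → ℝ} (h : ∀ i, l i ≤ l' i) (g : ι → ℝ) : quad l g ≤ quad l' g :=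
  Finset.sum_le_sum fun i _ => mul_le_mul_of_nonneg_right (h i) (sq_nonneg _)

theorem quad_const (a : ℝ) (g : ι → ℝ) : quad (fun _ => a) g = a * quad (fun _ => 1) g := by
  simp only [quad, Finset.mul_sum, one_mul]

theorem quad_one_nonneg (g : ι → ℝ) : 0 ≤ quad (fun _ => 1) g :=
  quad_nonneg (fun _ => zero_le_one) g

theorem quad_one_pos (hg : g ≠ 0) : 0 < quad (fun _ => 1) g :=
  quad_pos (fun _ => one_pos) hg

theorem rayleigh_mul_quad_one (l g : ι → ℝ) : rayleigh l g * quad (fun _ => 1) g = quad l g := by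
  rcases eq_or_ne g 0 with rfl | hg
  · simp [quad]
  · exact div_mul_cancel₀ _ (quad_one_pos hg).ne'

theorem quad_one_mul_one_sub_rayleigh (l g : ι → ℝ) :
    quad (fun _ => 1) g * (1 - rayleigh l g) = quad (fun _ => 1) g - quad l g := by
  rw [mul_sub, mul_one, mul_comm _ (rayleigh l g), rayleigh_mul_quad_one]

theorem rayleigh_mul_quad_one_div_quad (hl : ∀ i, 0 < l i) (hg : g ≠ 0) :
    rayleigh l g * (quad (fun _ => 1) g / quad l g) = 1 := by
  rw [rayleigh, div_mul_div_cancel₀ (quad_one_pos hg).ne', div_self (quad_pos hl hg).ne']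

theorem rayleigh_const_mul (a : ℝ) (l g : ι → ℝ) :
    rayleigh (fun i => a * l i) g = a * rayleigh l g := by
  simp only [rayleigh, quad, mul_assoc, ← Finset.mul_sum, mul_div_assoc]

theorem rayleigh_add_const (hg : g ≠ 0) (a : ℝ) :
    rayleigh (fun i => l i + a) g = rayleigh l g + a := by
  have hquad : quad (fun i => l i + a) g = quad l g + a * quad (fun _ => 1) g := by
    rw [← quad_const]
    simp only [quad, add_mul, Finset.sum_add_distrib]
  rw [rayleigh, hquad, add_div, mul_div_cancel_right₀ _ (quad_one_pos hg).ne', rayleigh]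

theorem rayleigh_nonneg (hl : ∀ i, 0 ≤ l i) (g : ι → ℝ) : 0 ≤ rayleigh l g :=
  div_nonneg (quad_nonneg hl g) (quad_one_nonneg g)

theorem rayleigh_le {M : ℝ} (hM : 0 ≤ M) (hl : ∀ i, l i ≤ M) (g : ι → ℝ) : rayleigh l g ≤ M :=
  div_le_of_le_mul₀ (quad_one_nonneg g) hM (quad_const M g ▸ quad_mono hl g)

theorem exists_norm_one_sub_rayleigh_le (hl : ∀ i, 0 ≤ l i) :
    ∃ C, ∀ g, ‖1 - rayleigh l g‖ ≤ C := by
  refine ⟨1 + ∑ i, l i, fun g => (norm_sub_le _ _).trans ?_⟩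
  rw [norm_one, Real.norm_of_nonneg (rayleigh_nonneg hl g)]
  exact add_le_add_right (rayleigh_le (Finset.sum_nonneg fun i _ => hl i)
    (fun i => Finset.single_le_sum (fun j _ => hl j) (Finset.mem_univ i)) g) _

theorem norm_one_sub_quad_one_div_quad_le {m : ℝ} (hm : 0 < m) (hml : ∀ i, m ≤ l i)
    (g : ι → ℝ) :
    ‖1 - quad (fun _ => 1) g / quad l g‖ ≤ 1 + 1 / m := by
  have hnonneg : 0 ≤ quad l g := quad_nonneg (fun i => hm.le.trans (hml i)) g
  refine (norm_sub_le _ _).trans ?_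
  rw [norm_one, Real.norm_of_nonneg (div_nonneg (quad_one_nonneg g) hnonneg)]
  refine add_le_add_right (div_le_of_le_mul₀ hnonneg (by positivity) ?_) _
  rw [one_div_mul_eq_div, le_div_iff₀' hm, ← quad_const]
  exact quad_mono hml g

theorem integrable_sq_one_sub_quad_one_div_quad {m : ℝ} (hm : 0 < m) (hml : ∀ i, m ≤ l i) :
    Integrable (fun g => (1 - quad (fun _ => 1) g / quad l g) ^ 2) (gaussianPi l) :=
  have hmeas : Measurable fun g => (1 - quad (fun _ => 1) g / quad l g) ^ 2 := by fun_prop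
  .of_bound hmeas.aestronglyMeasurable ((1 + 1 / m) ^ 2) <| ae_of_all _ fun g => by
    rw [norm_pow]
    exact pow_le_pow_left₀ (norm_nonneg _) (norm_one_sub_quad_one_div_quad_le hm hml g) 2

theorem pow_four_div_sq_quad_one_smul {t : ℝ} (ht : 0 < t) (g : ι → ℝ) (i : ι) :
    (t • g) i ^ 4 / quad (fun _ => 1) (t • g) ^ 2 = g i ^ 4 / quad (fun _ => 1) g ^ 2 := by
  rw [quad_smul, Pi.smul_apply, smul_eq_mul, mul_pow, mul_pow, ← pow_mul,
    mul_div_mul_left _ _ (pow_pos ht 4).ne']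

/-- The law on `ι → ℝ` with density proportional to `exp (-n * rayleigh l / 2)` with respect to
the standard normal measure, `n` being the dimension. -/
noncomputable def rayleighGibbs (l : ι → ℝ) : Measure (ι → ℝ) :=
  (gaussianPi fun _ => 1).tilted fun g => -(Fintype.card ι * rayleigh l g / 2)

theorem neg_card_mul_rayleigh_nonpos (hl : ∀ i, 0 ≤ l i) (g : ι → ℝ) :
    -(Fintype.card ι * rayleigh l g / 2) ≤ 0 := by
  have := rayleigh_nonneg hl g
  have : 0 ≤ Fintype.card ι * rayleigh l g / 2 := by positivity
  linarith

theorem rayleighGibbs_eq_tilted (l : ι → ℝ) : rayleighGibbs l =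
    (gaussianPi fun _ => 1).tilted fun g => Fintype.card ι * ((1 - rayleigh l g) / 2) := by
  rw [rayleighGibbs, ← tilted_add_const _ _ (Fintype.card ι / 2)]
  congr 1 with g
  ring

theorem integrable_exp_one_sub_rayleigh (hl : ∀ i, 0 ≤ l i) :
    Integrable (fun g => Real.exp (Fintype.card ι * ((1 - rayleigh l g) / 2)))
      (gaussianPi fun _ => 1) :=
  integrable_exp_of_bounded (B := Fintype.card ι / 2) (by fun_prop) fun g => by
    have := rayleigh_nonneg hl g
    rw [mul_div_assoc']
    gcongr
    exact mul_le_of_le_one_right (Nat.cast_nonneg _) (by linarith)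

theorem isProbabilityMeasure_rayleighGibbs (hl : ∀ i, 0 ≤ l i) :
    IsProbabilityMeasure (rayleighGibbs l) :=
  isProbabilityMeasure_tilted <|
    integrable_exp_of_bounded (by fun_prop) (neg_card_mul_rayleigh_nonpos hl)

theorem integrable_rayleighGibbs (hl : ∀ i, 0 ≤ l i) {f : (ι → ℝ) → ℝ}
    (hf : Integrable f (gaussianPi fun _ => 1)) : Integrable f (rayleighGibbs l) :=
  integrable_tilted_of_bounded (by fun_prop) (neg_card_mul_rayleigh_nonpos hl) hf

variable [Nonempty ι]

theorem rayleighGibbs_add_const (l : ι → ℝ) (a : ℝ) :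
    rayleighGibbs (fun i => l i + a) = rayleighGibbs l := by
  rw [rayleighGibbs, ← tilted_add_const _ _ (Fintype.card ι * a / 2)]
  refine tilted_congr ?_
  filter_upwards [ae_ne_zero_gaussianPi (l := fun _ : ι => 1) fun _ => one_pos] with g hg
  rw [rayleigh_add_const hg]
  ring

theorem integral_mul_comp_quad_gaussianPi (hl : ∀ i, 0 < l i) {A : (ι → ℝ) → ℝ}
    (hA : Measurable A) (hhom : ∀ t > (0 : ℝ), ∀ g, A (t • g) = A g) {φ : ℝ → ℝ}
    (hφ : Measurable φ) :
    ∫ g, A g * φ (quad l g) ∂(gaussianPi l) =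
      (∫ g, A g ∂(gaussianPi l)) * ∫ g, φ (quad l g) ∂(gaussianPi l) :=
  (indepFun_quad_gaussianPi hl hA hhom).integral_fun_comp_mul_comp (f := id) (by fun_prop)
    (by fun_prop) (by fun_prop) (by fun_prop)

/-- Tilting by a function of the direction does not affect the law of the length. -/
theorem integral_mul_comp_quad_rayleighGibbs {A : (ι → ℝ) → ℝ} (hA : Measurable A)
    (hhom : ∀ t > (0 : ℝ), ∀ g, A (t • g) = A g) {φ : ℝ → ℝ} (hφ : Measurable φ) :
    ∫ g, A g * φ (quad (fun _ => 1) g) ∂(rayleighGibbs l) =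
      (∫ g, A g ∂(rayleighGibbs l)) *
        ∫ g, φ (quad (fun _ => 1) g) ∂(gaussianPi fun _ : ι => 1) := by
  simp only [rayleighGibbs, integral_tilted_eq_div, mul_right_comm (A _)]
  rw [integral_mul_comp_quad_gaussianPi (fun _ => one_pos) (by fun_prop)
    (fun t ht g => by rw [hhom t ht, rayleigh_smul l ht]) hφ, mul_div_right_comm]

end Rayleigh

section Domination

/-- Jensen's inequality for the average over a random variable independent of the weight `A` and
the slope `Y`. -/
theorem integral_mul_exp_integral_mul_le {Ω : Type*} {mΩ : MeasurableSpace Ω} {P : Measure Ω}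
    {A Y R : Ω → ℝ} (hA : Measurable A) (hY : Measurable Y)
    (hind : IndepFun (fun ω => (A ω, Y ω)) R P) (hA₀ : ∀ ω, 0 ≤ A ω)
    (hAY : Integrable (fun ω => A ω * Real.exp ((∫ ω, R ω ∂P) * Y ω)) P)
    (hAY' : Integrable (fun ω => A ω * Real.exp ((∫ ω, R ω ∂P) * Y ω) * Y ω) P)
    (hR₁ : Integrable R P) (hAR : Integrable (fun ω => A ω * Real.exp (R ω * Y ω)) P) :
    ∫ ω, A ω * Real.exp ((∫ ω, R ω ∂P) * Y ω) ∂P ≤ ∫ ω, A ω * Real.exp (R ω * Y ω) ∂P := by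
  set r := ∫ ω, R ω ∂P
  have hind' : IndepFun (fun ω => A ω * Real.exp (r * Y ω) * Y ω) R P :=
    hind.comp (φ := fun p : ℝ × ℝ => p.1 * Real.exp (r * p.2) * p.2) (by fun_prop) measurable_id
  have hYR : Integrable (fun ω => A ω * Real.exp (r * Y ω) * Y ω * R ω) P :=
    hind'.integrable_mul hAY' hR₁
  have hcentred : ∫ ω, A ω * Real.exp (r * Y ω) * Y ω * (R ω - r) ∂P = 0 := by
    simp only [mul_sub]
    rw [integral_sub hYR (hAY'.mul_const r), hind'.integral_fun_mul_eq_mul_integral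
      (by fun_prop) hR₁.aestronglyMeasurable, integral_mul_const, sub_self]
  have hcentred_int : Integrable (fun ω => A ω * Real.exp (r * Y ω) * Y ω * (R ω - r)) P := by
    simp only [mul_sub]
    exact hYR.sub (hAY'.mul_const r)
  rw [← add_zero (∫ ω, A ω * Real.exp (r * Y ω) ∂P), ← hcentred, ← integral_add hAY hcentred_int]
  refine integral_mono (hAY.add hcentred_int) hAR fun ω => ?_
  have htangent : Real.exp (r * Y ω) * (Y ω * (R ω - r) + 1) ≤ Real.exp (R ω * Y ω) :=
    calc Real.exp (r * Y ω) * (Y ω * (R ω - r) + 1)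
      _ ≤ Real.exp (r * Y ω) * Real.exp (Y ω * (R ω - r)) :=
        mul_le_mul_of_nonneg_left (Real.add_one_le_exp _) (Real.exp_pos _).le
      _ = Real.exp (R ω * Y ω) := by
        rw [← Real.exp_add]
        ring_nf
  calc A ω * Real.exp (r * Y ω) + A ω * Real.exp (r * Y ω) * Y ω * (R ω - r)
    _ = A ω * (Real.exp (r * Y ω) * (Y ω * (R ω - r) + 1)) := by ring
    _ ≤ A ω * Real.exp (R ω * Y ω) := mul_le_mul_of_nonneg_left htangent (hA₀ ω)

variable {ι : Type*} [Fintype ι] {l : ι → ℝ} {M : ℝ}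

theorem exp_integral_mul_le (hl : ∀ i, 0 < l i) :
    Real.exp (∫ g, (Fintype.card ι - quad (fun _ => 1) g) * (1 - rayleigh l g) / 2
        ∂(gaussianPi l)) *
      ∫ g, Real.exp ((quad (fun _ => 1) g - quad l g) / 2) ∂(gaussianPi fun _ => 1) ≤
    ∫ g, Real.exp (Fintype.card ι * ((1 - rayleigh l g) / 2)) ∂(gaussianPi fun _ => 1) := by
  set V : (ι → ℝ) → ℝ :=
    fun g => (Fintype.card ι - quad (fun _ => 1) g) * (1 - rayleigh l g) / 2
  obtain ⟨C, hC⟩ := exists_norm_one_sub_rayleigh_le fun i => (hl i).le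
  have hint := integrable_exp_quad_sub (l := fun _ => 1) (fun _ => one_pos) hl
  have hexp (g : ι → ℝ) : (quad (fun _ => 1) g - quad l g) / 2 + V g =
      Fintype.card ι * ((1 - rayleigh l g) / 2) := by
    rw [← quad_one_mul_one_sub_rayleigh]
    ring
  have hV : Integrable V (gaussianPi l) :=
    (((integrable_const _).sub (integrable_quad_gaussianPi _ _)).mul_bdd (by fun_prop)
      (ae_of_all _ hC)).div_const 2
  have hexpV : Integrable (fun g => Real.exp (V g)) (gaussianPi l) := by
    rw [← gaussianPi_tilted (l := fun _ => 1) (fun _ => one_pos) hl, integrable_tilted_iff hint]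
    simp only [smul_eq_mul, ← Real.exp_add, hexp]
    exact integrable_exp_one_sub_rayleigh fun i => (hl i).le
  have hjensen : Real.exp (∫ g, V g ∂(gaussianPi l)) ≤ ∫ g, Real.exp (V g) ∂(gaussianPi l) :=
    convexOn_exp.map_integral_le Real.continuous_exp.continuousOn isClosed_univ
      (ae_of_all _ fun _ => mem_univ _) hV hexpV
  have hratio : ∫ g, Real.exp (V g) ∂(gaussianPi l) =
      (∫ g, Real.exp (Fintype.card ι * ((1 - rayleigh l g) / 2)) ∂(gaussianPi fun _ => 1)) /
        ∫ g, Real.exp ((quad (fun _ => 1) g - quad l g) / 2) ∂(gaussianPi fun _ => 1) := by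
    simp only [← hexp]
    rw [← gaussianPi_tilted (l := fun _ => 1) (fun _ => one_pos) hl, integral_exp_tilted]
    rfl
  rwa [hratio, le_div_iff₀ (integral_exp_pos hint)] at hjensen

theorem integral_card_sub_quad_one_mul (hl : ∀ i, 0 < l i)
    (hsum : ∑ i, 1 / l i = Fintype.card ι) :
    ∫ g, (Fintype.card ι - quad (fun _ => 1) g) * (1 - rayleigh l g) ∂(gaussianPi l) =
      Fintype.card ι * ∫ g, (1 - rayleigh l g) ∂(gaussianPi l) := by
  obtain ⟨C, hC⟩ := exists_norm_one_sub_rayleigh_le fun i => (hl i).le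
  have hint : Integrable (fun g => 1 - rayleigh l g) (gaussianPi l) :=
    .of_bound (by fun_prop) C (ae_of_all _ hC)
  have hdiff : Integrable (fun g => quad (fun _ => 1) g - quad l g) (gaussianPi l) :=
    (integrable_quad_gaussianPi _ _).sub (integrable_quad_gaussianPi _ _)
  have hmean : ∫ g, (quad (fun _ => 1) g - quad l g) ∂(gaussianPi l) = 0 := by
    rw [integral_sub (integrable_quad_gaussianPi _ _) (integrable_quad_gaussianPi _ _),
      integral_quad_gaussianPi hl, integral_quad_gaussianPi hl, hsum]
    simp [div_self (hl _).ne']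
  simp only [sub_mul _ (quad _ _), quad_one_mul_one_sub_rayleigh]
  rw [integral_sub (hint.const_mul _) hdiff, hmean, sub_zero,
    integral_const_mul]

variable [Nonempty ι]

theorem integral_mul_exp_one_sub_rayleigh_le (hl : ∀ i, 0 < l i)
    {A : (ι → ℝ) → ℝ} (hA : Measurable A) (hA₀ : ∀ g, 0 ≤ A g) {C : ℝ} (hAC : ∀ g, A g ≤ C)
    (hhom : ∀ t > (0 : ℝ), ∀ g, A (t • g) = A g) :
    ∫ g, A g * Real.exp (Fintype.card ι * ((1 - rayleigh l g) / 2)) ∂(gaussianPi fun _ => 1) ≤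
      ∫ g, A g * Real.exp ((quad (fun _ => 1) g - quad l g) / 2) ∂(gaussianPi fun _ => 1) := by
  obtain ⟨C', hC'⟩ := exists_norm_one_sub_rayleigh_le fun i => (hl i).le
  have hA_bdd : ∀ᵐ g ∂gaussianPi fun _ : ι => (1 : ℝ), ‖A g‖ ≤ C :=
    ae_of_all _ fun g => by rw [Real.norm_of_nonneg (hA₀ g)]; exact hAC g
  have hAY := (integrable_exp_one_sub_rayleigh (l := l) fun i => (hl i).le).bdd_mul
    (by fun_prop) hA_bdd
  have hAR := (integrable_exp_quad_sub (l := fun _ => 1) (fun _ => one_pos) hl).bdd_mul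
    (by fun_prop) hA_bdd
  have hind := indepFun_quad_gaussianPi (l := fun _ : ι => 1) (fun _ => one_pos)
    (A := fun g => (A g, (1 - rayleigh l g) / 2)) (by fun_prop)
    fun t ht g => by rw [hhom t ht, rayleigh_smul l ht]
  have hexp (g : ι → ℝ) : quad (fun _ => 1) g * ((1 - rayleigh l g) / 2) =
      (quad (fun _ => 1) g - quad l g) / 2 := by
    rw [mul_div_assoc', quad_one_mul_one_sub_rayleigh]
  have h := integral_mul_exp_integral_mul_le hA (by fun_prop) hind hA₀
  simp only [integral_quad_one_gaussianPi, hexp] at h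
  exact h hAY (hAY.mul_bdd (by fun_prop) (ae_of_all _ fun g => by
    rw [norm_div]
    exact div_le_div_of_nonneg_right (hC' g) (norm_nonneg (2 : ℝ))))
    (integrable_quad_gaussianPi _ _) hAR

theorem integral_quad_one_div_quad (hl : ∀ i, 0 < l i) (hsum : ∑ i, 1 / l i = Fintype.card ι) :
    ∫ g, quad (fun _ => 1) g / quad l g ∂(gaussianPi l) = 1 := by
  have hcard : (Fintype.card ι : ℝ) ≠ 0 := Nat.cast_ne_zero.2 Fintype.card_ne_zero
  have h := integral_mul_comp_quad_gaussianPi hl (φ := id)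
    (A := fun g => quad (fun _ => 1) g / quad l g) (by fun_prop)
    (fun t ht g => quad_div_quad_smul _ l ht g) measurable_id
  have hcancel : ∫ g, quad (fun _ => 1) g / quad l g * quad l g ∂(gaussianPi l) =
      ∫ g, quad (fun _ => 1) g ∂(gaussianPi l) := by
    refine integral_congr_ae ?_
    filter_upwards [ae_ne_zero_gaussianPi hl] with g hg
    exact div_mul_cancel₀ _ (quad_pos hl hg).ne'
  simp only [hcancel, id, integral_quad_gaussianPi hl, hsum, div_self (hl _).ne',
    Finset.sum_const, Finset.card_univ, nsmul_eq_mul, mul_one] at h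
  exact (eq_div_of_mul_eq hcard h.symm).trans (div_self hcard)

variable {m : ℝ}

theorem card_mul_integral_sq_one_sub_le (hm : 0 < m) (hml : ∀ i, m ≤ l i)
    (hsum : ∑ i, 1 / l i = Fintype.card ι) :
    Fintype.card ι * ∫ g, (1 - quad (fun _ => 1) g / quad l g) ^ 2 ∂(gaussianPi l) ≤
      normalFourthMoment * (1 + 1 / m) ^ 2 := by
  have hl : ∀ i, 0 < l i := fun i => hm.trans_le (hml i)
  have hcard : 0 < (Fintype.card ι : ℝ) := Nat.cast_pos.2 Fintype.card_pos
  set I := ∫ g, (1 - quad (fun _ => 1) g / quad l g) ^ 2 ∂(gaussianPi l)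
  have hmean : ∫ g, quad (fun i => l i - 1) g ∂(gaussianPi l) = 0 := by
    simp [integral_quad_gaussianPi hl, sub_div, div_self (hl _).ne', hsum, -one_div]
  have hfactor :
      I * ∫ g, quad l g ^ 2 ∂(gaussianPi l) = Var[quad fun i => l i - 1; gaussianPi l] := by
    rw [variance_of_integral_eq_zero (by fun_prop) hmean, ← integral_mul_comp_quad_gaussianPi hl
      (φ := fun r => r ^ 2) (by fun_prop) (fun t ht g => by rw [quad_div_quad_smul _ l ht])
      (by fun_prop)]
    refine integral_congr_ae ?_
    filter_upwards [ae_ne_zero_gaussianPi hl] with g hg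
    rw [← mul_pow, sub_mul, one_mul, div_mul_cancel₀ _ (quad_pos hl hg).ne']
    simp only [quad, sub_mul, Finset.sum_sub_distrib]
  have hterm (i : ι) : ((l i - 1) / l i) ^ 2 ≤ (1 + 1 / m) ^ 2 := by
    have hinv : 1 / l i ≤ 1 / m := one_div_le_one_div_of_le hm (hml i)
    have hinv₀ : 0 < 1 / l i := one_div_pos.2 (hl i)
    rw [sub_div, div_self (hl i).ne']
    exact sq_le_sq' (by linarith) (by linarith)
  have hsq : (Fintype.card ι : ℝ) ^ 2 ≤ ∫ g, quad l g ^ 2 ∂(gaussianPi l) := by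
    simpa [div_self (hl _).ne'] using sq_sum_div_le_integral_sq_quad_gaussianPi hl l
  refine le_of_mul_le_mul_right ?_ hcard
  calc Fintype.card ι * I * Fintype.card ι
    _ = I * (Fintype.card ι : ℝ) ^ 2 := by ring
    _ ≤ I * ∫ g, quad l g ^ 2 ∂(gaussianPi l) :=
      mul_le_mul_of_nonneg_left hsq (integral_nonneg fun g => sq_nonneg _)
    _ ≤ normalFourthMoment * ∑ i, ((l i - 1) / l i) ^ 2 :=
      hfactor.trans_le (variance_quad_gaussianPi_le hl _)
    _ ≤ normalFourthMoment * ∑ _i : ι, (1 + 1 / m) ^ 2 :=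
      mul_le_mul_of_nonneg_left (Finset.sum_le_sum fun i _ => hterm i) normalFourthMoment_nonneg
    _ = normalFourthMoment * (1 + 1 / m) ^ 2 * Fintype.card ι := by
      rw [Finset.sum_const, Finset.card_univ, nsmul_eq_mul]
      ring

theorem neg_mul_le_integral_card_sub_quad_one_mul (hm : 0 < m) (hml : ∀ i, m ≤ l i)
    (hlM : ∀ i, l i ≤ M) (hsum : ∑ i, 1 / l i = Fintype.card ι) :
    -(M * (normalFourthMoment * (1 + 1 / m) ^ 2)) ≤
      ∫ g, (Fintype.card ι - quad (fun _ => 1) g) * (1 - rayleigh l g) ∂(gaussianPi l) := by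
  have hl : ∀ i, 0 < l i := fun i => hm.trans_le (hml i)
  have hM : 0 ≤ M := (hl (Classical.arbitrary ι)).le.trans (hlM _)
  set y : (ι → ℝ) → ℝ := fun g => quad (fun _ => 1) g / quad l g
  obtain ⟨C, hC⟩ := exists_norm_one_sub_rayleigh_le fun i => (hl i).le
  have hx_int : Integrable (fun g => 1 - rayleigh l g) (gaussianPi l) :=
    .of_bound (by fun_prop) C (ae_of_all _ hC)
  have hy_int : Integrable (fun g => 1 - y g) (gaussianPi l) :=
    .of_bound (by fun_prop) _ (ae_of_all _ (norm_one_sub_quad_one_div_quad_le hm hml))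
  have hpointwise : ∀ᵐ g ∂gaussianPi l,
      -(M * (1 - y g) ^ 2) ≤ (1 - rayleigh l g) + (1 - y g) := by
    filter_upwards [ae_ne_zero_gaussianPi hl] with g hg
    have hxy : rayleigh l g * y g = 1 := rayleigh_mul_quad_one_div_quad hl hg
    calc -(M * (1 - y g) ^ 2)
      _ ≤ -(rayleigh l g * (1 - y g) ^ 2) :=
        neg_le_neg (mul_le_mul_of_nonneg_right (rayleigh_le hM hlM g) (sq_nonneg _))
      _ = (1 - rayleigh l g) + (1 - y g) := by linear_combination (y g - 2) * -hxy
  have hy_mean : ∫ g, (1 - y g) ∂(gaussianPi l) = 0 := by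
    have hmean : ∫ g, y g ∂(gaussianPi l) = 1 := integral_quad_one_div_quad hl hsum
    rw [integral_sub (integrable_const _) (.of_integral_ne_zero (hmean ▸ one_ne_zero)), hmean]
    simp
  calc -(M * (normalFourthMoment * (1 + 1 / m) ^ 2))
    _ ≤ -(M * (Fintype.card ι * ∫ g, (1 - y g) ^ 2 ∂(gaussianPi l))) :=
      neg_le_neg (mul_le_mul_of_nonneg_left (card_mul_integral_sq_one_sub_le hm hml hsum) hM)
    _ = Fintype.card ι * ∫ g, -(M * (1 - y g) ^ 2) ∂(gaussianPi l) := by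
      rw [integral_neg, integral_const_mul]
      ring
    _ ≤ Fintype.card ι * ∫ g, ((1 - rayleigh l g) + (1 - y g)) ∂(gaussianPi l) :=
      mul_le_mul_of_nonneg_left (integral_mono_ae
        ((integrable_sq_one_sub_quad_one_div_quad hm hml).const_mul M).neg (hx_int.add hy_int)
        hpointwise) (Nat.cast_nonneg _)
    _ = ∫ g, (Fintype.card ι - quad (fun _ => 1) g) * (1 - rayleigh l g) ∂(gaussianPi l) := by
      rw [integral_add hx_int hy_int, hy_mean, add_zero, integral_card_sub_quad_one_mul hl hsum]

/-- The factor by which the Gibbs law of the direction is dominated by that of a Gaussian vector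
with precisions in `[m, M]`. -/
noncomputable def dominationConst (m M : ℝ) : ℝ :=
  Real.exp (M * (normalFourthMoment * (1 + 1 / m) ^ 2) / 2)

theorem integral_rayleighGibbs_le (hm : 0 < m) (hml : ∀ i, m ≤ l i) (hlM : ∀ i, l i ≤ M)
    (hsum : ∑ i, 1 / l i = Fintype.card ι) {A : (ι → ℝ) → ℝ} (hA : Measurable A)
    (hA₀ : ∀ g, 0 ≤ A g) {C : ℝ} (hAC : ∀ g, A g ≤ C)
    (hhom : ∀ t > (0 : ℝ), ∀ g, A (t • g) = A g) :
    ∫ g, A g ∂(rayleighGibbs l) ≤ dominationConst m M * ∫ g, A g ∂(gaussianPi l) := by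
  have hl : ∀ i, 0 < l i := fun i => hm.trans_le (hml i)
  set Z := ∫ g, Real.exp (Fintype.card ι * ((1 - rayleigh l g) / 2)) ∂(gaussianPi fun _ => 1)
  set Z' := ∫ g, Real.exp ((quad (fun _ => 1) g - quad l g) / 2) ∂(gaussianPi fun _ => 1)
  set I := ∫ g, A g * Real.exp ((quad (fun _ => 1) g - quad l g) / 2) ∂(gaussianPi fun _ => 1)
  have hZ : 0 < Z := integral_exp_pos (integrable_exp_one_sub_rayleigh fun i => (hl i).le)
  have hZ' : 0 < Z' := integral_exp_pos (integrable_exp_quad_sub (fun _ => one_pos) hl)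
  have hI : 0 ≤ I := integral_nonneg fun g => mul_nonneg (hA₀ g) (Real.exp_pos _).le
  have hpartition : Z' ≤ dominationConst m M * Z := by
    rw [dominationConst, ← inv_mul_le_iff₀ (Real.exp_pos _), ← Real.exp_neg]
    refine (mul_le_mul_of_nonneg_right (Real.exp_le_exp.2 ?_) hZ'.le).trans (exp_integral_mul_le hl)
    rw [integral_div]
    linarith [neg_mul_le_integral_card_sub_quad_one_mul hm hml hlM hsum]
  rw [rayleighGibbs_eq_tilted, ← gaussianPi_tilted (l := fun _ => 1) (fun _ => one_pos) hl,
    integral_tilted_eq_div, integral_tilted_eq_div, mul_div_assoc',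
    div_le_div_iff₀ hZ hZ']
  calc _ ≤ I * Z' :=
      mul_le_mul_of_nonneg_right (integral_mul_exp_one_sub_rayleigh_le hl hA hA₀ hAC hhom) hZ'.le
    _ ≤ I * (dominationConst m M * Z) := mul_le_mul_of_nonneg_left hpartition hI
    _ = _ := by ring

theorem dominationConst_nonneg (m M : ℝ) : 0 ≤ dominationConst m M :=
  (Real.exp_pos _).le

theorem card_mul_integral_sq_rayleigh_sub_one_le (hm : 0 < m) (hml : ∀ i, m ≤ l i)
    (hlM : ∀ i, l i ≤ M) (hsum : ∑ i, 1 / l i = Fintype.card ι) :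
    Fintype.card ι * ∫ g, (rayleigh l g - 1) ^ 2 ∂(rayleighGibbs l) ≤
      dominationConst m M * (M ^ 2 * (normalFourthMoment * (1 + 1 / m) ^ 2)) := by
  have hl : ∀ i, 0 < l i := fun i => hm.trans_le (hml i)
  have hM : 0 ≤ M := (hl (Classical.arbitrary ι)).le.trans (hlM _)
  set y : (ι → ℝ) → ℝ := fun g => quad (fun _ => 1) g / quad l g
  have hy_sq_int : Integrable (fun g => (1 - y g) ^ 2) (gaussianPi l) :=
    integrable_sq_one_sub_quad_one_div_quad hm hml
  have hcompare : ∫ g, (rayleigh l g - 1) ^ 2 ∂(gaussianPi l) ≤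
      ∫ g, M ^ 2 * (1 - y g) ^ 2 ∂(gaussianPi l) := by
    refine integral_mono_of_nonneg (ae_of_all _ fun g => sq_nonneg _) (hy_sq_int.const_mul _) ?_
    filter_upwards [ae_ne_zero_gaussianPi hl] with g hg
    have hxy : rayleigh l g * (1 - y g) = rayleigh l g - 1 := by
      rw [mul_sub, mul_one, rayleigh_mul_quad_one_div_quad hl hg]
    have hx₀ := rayleigh_nonneg (fun i => (hl i).le) g
    simp only [← hxy, mul_pow]
    gcongr
    exact rayleigh_le hM hlM g
  obtain ⟨C, hC⟩ := exists_norm_one_sub_rayleigh_le fun i => (hl i).le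
  have hdom := integral_rayleighGibbs_le hm hml hlM hsum (A := fun g => (rayleigh l g - 1) ^ 2)
    (by fun_prop) (fun g => sq_nonneg _) (C := C ^ 2)
    (fun g => by
      rw [← sq_abs, abs_sub_comm]
      exact pow_le_pow_left₀ (abs_nonneg _) (hC g) 2)
    fun t ht g => by rw [rayleigh_smul l ht]
  calc _ ≤ Fintype.card ι * (dominationConst m M * ∫ g, M ^ 2 * (1 - y g) ^ 2 ∂(gaussianPi l)) := by
        gcongr
        exact hdom.trans (mul_le_mul_of_nonneg_left hcompare (dominationConst_nonneg m M))
    _ = dominationConst m M * (M ^ 2 *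
          (Fintype.card ι * ∫ g, (1 - y g) ^ 2 ∂(gaussianPi l))) := by
        rw [integral_const_mul]
        ring
    _ ≤ dominationConst m M * (M ^ 2 * (normalFourthMoment * (1 + 1 / m) ^ 2)) :=
      mul_le_mul_of_nonneg_left (mul_le_mul_of_nonneg_left
        (card_mul_integral_sq_one_sub_le hm hml hsum) (sq_nonneg M)) (dominationConst_nonneg m M)

theorem integral_sq_quad_one_gaussianPi_le :
    ∫ g, quad (fun _ => 1) g ^ 2 ∂(gaussianPi fun _ : ι => 1) ≤
      (normalFourthMoment + 1) * (Fintype.card ι : ℝ) ^ 2 := by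
  have hvar := variance_eq_sub (memLp_quad_gaussianPi (fun _ : ι => 1) fun _ => 1)
  rw [integral_quad_one_gaussianPi] at hvar
  have hcard : (1 : ℝ) ≤ Fintype.card ι := Nat.one_le_cast.2 Fintype.card_pos
  calc ∫ g, quad (fun _ => 1) g ^ 2 ∂(gaussianPi fun _ : ι => 1)
    _ = Var[quad fun _ => 1; gaussianPi fun _ : ι => 1] + (Fintype.card ι : ℝ) ^ 2 :=
      (sub_eq_iff_eq_add.1 hvar.symm)
    _ ≤ normalFourthMoment * Fintype.card ι + (Fintype.card ι : ℝ) ^ 2 :=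
      add_le_add_left variance_quad_one_gaussianPi_le _
    _ ≤ normalFourthMoment * (Fintype.card ι : ℝ) ^ 2 + (Fintype.card ι : ℝ) ^ 2 :=
      add_le_add_left (mul_le_mul_of_nonneg_left (le_self_pow₀ hcard two_ne_zero)
        normalFourthMoment_nonneg) _
    _ = (normalFourthMoment + 1) * (Fintype.card ι : ℝ) ^ 2 := by ring

theorem sq_card_mul_integral_pow_four_div_le (hm : 0 < m) (hml : ∀ i, m ≤ l i)
    (hlM : ∀ i, l i ≤ M) (i : ι) :
    (Fintype.card ι : ℝ) ^ 2 * ∫ g, g i ^ 4 / quad (fun _ => 1) g ^ 2 ∂(gaussianPi l) ≤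
      M ^ 2 * (normalFourthMoment / m ^ 2) := by
  have hl : ∀ i, 0 < l i := fun i => hm.trans_le (hml i)
  have hM : 0 ≤ M := (hl i).le.trans (hlM i)
  have hsq : (Fintype.card ι : ℝ) ^ 2 ≤ ∫ g, quad l g ^ 2 ∂(gaussianPi l) := by
    simpa [div_self (hl _).ne'] using sq_sum_div_le_integral_sq_quad_gaussianPi hl l
  set A : (ι → ℝ) → ℝ := fun g => g i ^ 4 / quad (fun _ => 1) g ^ 2
  have hA₀ (g : ι → ℝ) : 0 ≤ A g := by positivity
  have hA_mul (g : ι → ℝ) : A g * quad l g ^ 2 = rayleigh l g ^ 2 * g i ^ 4 := by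
    rw [rayleigh, div_pow]
    ring
  calc (Fintype.card ι : ℝ) ^ 2 * ∫ g, A g ∂(gaussianPi l)
    _ ≤ (∫ g, A g ∂(gaussianPi l)) * ∫ g, quad l g ^ 2 ∂(gaussianPi l) := by
      rw [mul_comm]
      exact mul_le_mul_of_nonneg_left hsq (integral_nonneg hA₀)
    _ = ∫ g, rayleigh l g ^ 2 * g i ^ 4 ∂(gaussianPi l) := by
      simp only [← hA_mul]
      exact (integral_mul_comp_quad_gaussianPi hl (φ := fun r => r ^ 2) (by fun_prop)
        (fun t ht g => pow_four_div_sq_quad_one_smul ht g i) (by fun_prop)).symm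
    _ ≤ ∫ g, M ^ 2 * g i ^ 4 ∂(gaussianPi l) :=
      integral_mono_of_nonneg (ae_of_all _ fun g => by positivity)
        ((integrable_pow_gaussianPi l 4 i).const_mul _) <| ae_of_all _ fun g =>
          mul_le_mul_of_nonneg_right (pow_le_pow_left₀ (rayleigh_nonneg (fun j => (hl j).le) g)
            (rayleigh_le hM hlM g) 2) (by positivity)
    _ = M ^ 2 * (normalFourthMoment / l i ^ 2) := by
      rw [integral_const_mul, integral_pow_four_gaussianPi hl]
    _ ≤ M ^ 2 * (normalFourthMoment / m ^ 2) := by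
      have := normalFourthMoment_nonneg
      gcongr
      exact hml i

theorem integral_pow_four_rayleighGibbs_le (hm : 0 < m) (hml : ∀ i, m ≤ l i)
    (hlM : ∀ i, l i ≤ M) (hsum : ∑ i, 1 / l i = Fintype.card ι) (i : ι) :
    ∫ g, g i ^ 4 ∂(rayleighGibbs l) ≤
      dominationConst m M * (M ^ 2 * (normalFourthMoment / m ^ 2)) * (normalFourthMoment + 1) := by
  set A : (ι → ℝ) → ℝ := fun g => g i ^ 4 / quad (fun _ => 1) g ^ 2
  have hsq_le (g : ι → ℝ) : g i ^ 2 ≤ quad (fun _ => 1) g := by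
    simpa [quad] using Finset.single_le_sum (fun j _ => sq_nonneg (g j)) (Finset.mem_univ i)
  have hA₀ (g : ι → ℝ) : 0 ≤ A g := by positivity
  have hA₁ (g : ι → ℝ) : A g ≤ 1 := by
    refine div_le_one_of_le₀ ?_ (sq_nonneg _)
    rw [show g i ^ 4 = (g i ^ 2) ^ 2 by ring]
    exact pow_le_pow_left₀ (sq_nonneg _) (hsq_le g) 2
  have hA_mul (g : ι → ℝ) : A g * quad (fun _ => 1) g ^ 2 = g i ^ 4 := by
    refine div_mul_cancel_of_imp fun h => ?_
    have : g i ^ 2 = 0 := le_antisymm ((hsq_le g).trans_eq (pow_eq_zero_iff two_ne_zero |>.1 h))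
      (sq_nonneg _)
    rw [show g i ^ 4 = (g i ^ 2) ^ 2 by ring, this, zero_pow two_ne_zero]
  have hhom : ∀ t > (0 : ℝ), ∀ g, A (t • g) = A g :=
    fun t ht g => pow_four_div_sq_quad_one_smul ht g i
  have hD := dominationConst_nonneg m M
  have := normalFourthMoment_nonneg
  calc ∫ g, g i ^ 4 ∂(rayleighGibbs l)
    _ = (∫ g, A g ∂(rayleighGibbs l)) *
          ∫ g, quad (fun _ => 1) g ^ 2 ∂(gaussianPi fun _ : ι => 1) := by
      simp only [← hA_mul]
      exact integral_mul_comp_quad_rayleighGibbs (φ := fun r => r ^ 2) (by fun_prop) hhom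
        (by fun_prop)
    _ ≤ (dominationConst m M * ∫ g, A g ∂(gaussianPi l)) *
          ((normalFourthMoment + 1) * (Fintype.card ι : ℝ) ^ 2) :=
      mul_le_mul (integral_rayleighGibbs_le hm hml hlM hsum (by fun_prop) hA₀ hA₁ hhom)
        integral_sq_quad_one_gaussianPi_le (integral_nonneg fun g => sq_nonneg _)
        (mul_nonneg hD (integral_nonneg hA₀))
    _ = dominationConst m M * ((Fintype.card ι : ℝ) ^ 2 * ∫ g, A g ∂(gaussianPi l)) *
          (normalFourthMoment + 1) := by ring
    _ ≤ dominationConst m M * (M ^ 2 * (normalFourthMoment / m ^ 2)) *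
          (normalFourthMoment + 1) := by
      exact mul_le_mul_of_nonneg_right (mul_le_mul_of_nonneg_left
        (sq_card_mul_integral_pow_four_div_le hm hml hlM i) hD) (by linarith)

theorem integral_sq_quad_one_sub_card_rayleighGibbs_le (hl : ∀ i, 0 ≤ l i) :
    ∫ g, (quad (fun _ => 1) g - Fintype.card ι) ^ 2 ∂(rayleighGibbs l) ≤
      normalFourthMoment * Fintype.card ι := by
  have := isProbabilityMeasure_rayleighGibbs hl
  have h := integral_mul_comp_quad_rayleighGibbs (l := l) (A := fun _ => 1)
    (φ := fun r => (r - Fintype.card ι) ^ 2) (by fun_prop) (fun _ _ _ => rfl) (by fun_prop)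
  simp only [one_mul, integral_const, probReal_univ, smul_eq_mul] at h
  rw [h, ← integral_quad_one_gaussianPi, ← variance_eq_integral (by fun_prop),
    integral_quad_one_gaussianPi]
  exact variance_quad_one_gaussianPi_le

end Domination

section Involution

theorem abs_exp_sub_exp_le (x y : ℝ) :
    |Real.exp x - Real.exp y| ≤ min 1 |x - y| * (Real.exp x + Real.exp y) := by
  wlog h : y ≤ x generalizing x y
  · rw [abs_sub_comm, abs_sub_comm x y, add_comm]
    exact this y x (not_le.1 h).le
  have hfactor : Real.exp x - Real.exp y = (1 - Real.exp (y - x)) * Real.exp x := by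
    rw [sub_mul, one_mul, ← Real.exp_add, sub_add_cancel]
  have hmin : 1 - Real.exp (y - x) ≤ min 1 (x - y) :=
    le_min (by linarith [Real.exp_pos (y - x)]) (by linarith [Real.add_one_le_exp (y - x)])
  rw [abs_of_nonneg (sub_nonneg.2 (Real.exp_le_exp.2 h)), abs_of_nonneg (sub_nonneg.2 h), hfactor]
  exact mul_le_mul hmin (le_add_of_nonneg_right (Real.exp_pos y).le) (Real.exp_pos x).le
    (le_min zero_le_one (sub_nonneg.2 h))

variable {Ω : Type*} {mΩ : MeasurableSpace Ω} {μ : Measure Ω} {T : Ω → Ω}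

theorem integral_comp_of_involutive (hT : MeasurePreserving T μ μ) (hTT : Function.Involutive T)
    (f : Ω → ℝ) : ∫ x, f (T x) ∂μ = ∫ x, f x ∂μ :=
  hT.integral_comp (MeasurableEquiv.ofInvolutive T hTT hT.measurable).measurableEmbedding f

theorem abs_integral_tilted_sub_comp_le (hT : MeasurePreserving T μ μ)
    (hTT : Function.Involutive T) {u : Ω → ℝ} (hu : Measurable u)
    (hexp : Integrable (fun x => Real.exp (u x)) μ) {f : Ω → ℝ} (hf : Measurable f) {B : ℝ}
    (hB : ∀ x, |f x| ≤ B) :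
    |∫ x, f x ∂(μ.tilted u) - ∫ x, f (T x) ∂(μ.tilted u)| ≤
      2 * B * ∫ x, min 1 |u x - u (T x)| ∂(μ.tilted u) := by
  have hTm := hT.measurable
  have hexpT : Integrable (fun x => Real.exp (u (T x))) μ :=
    hT.integrable_comp_of_integrable hexp
  set δ : Ω → ℝ := fun x => min 1 |u x - u (T x)|
  have hδ : ∀ x, ‖δ x‖ ≤ 1 := fun x => by
    rw [Real.norm_of_nonneg (le_min zero_le_one (abs_nonneg _))]
    exact min_le_left _ _
  have hf_mul {w : Ω → ℝ} (hw : Integrable w μ) : Integrable (fun x => f x * w x) μ :=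
    hw.bdd_mul hf.aestronglyMeasurable (ae_of_all _ hB)
  have hδ_mul {w : Ω → ℝ} (hw : Integrable w μ) : Integrable (fun x => δ x * w x) μ :=
    hw.bdd_mul (by fun_prop) (ae_of_all _ hδ)
  have hf_comp : ∫ x, f (T x) * Real.exp (u x) ∂μ = ∫ x, f x * Real.exp (u (T x)) ∂μ := by
    simpa only [hTT _] using
      (integral_comp_of_involutive hT hTT fun x => f (T x) * Real.exp (u x)).symm
  have hδ_comp : ∫ x, δ x * Real.exp (u (T x)) ∂μ = ∫ x, δ x * Real.exp (u x) ∂μ := by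
    simpa only [δ, hTT _, abs_sub_comm (u (T _))] using
      integral_comp_of_involutive hT hTT fun x => δ x * Real.exp (u x)
  have hZ : 0 ≤ ∫ x, Real.exp (u x) ∂μ := integral_nonneg fun x => (Real.exp_pos _).le
  simp only [integral_tilted_eq_div]
  rw [hf_comp, ← sub_div, abs_div, abs_of_nonneg hZ, ← mul_div_assoc,
    ← integral_sub (hf_mul hexp) (hf_mul hexpT)]
  refine div_le_div_of_nonneg_right ?_ hZ
  calc |∫ x, (f x * Real.exp (u x) - f x * Real.exp (u (T x))) ∂μ|
    _ ≤ ∫ x, |f x * Real.exp (u x) - f x * Real.exp (u (T x))| ∂μ := abs_integral_le_integral_abs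
    _ ≤ ∫ x, B * (δ x * Real.exp (u x) + δ x * Real.exp (u (T x))) ∂μ := by
      refine integral_mono ((hf_mul hexp).sub (hf_mul hexpT)).abs
        (((hδ_mul hexp).add (hδ_mul hexpT)).const_mul B) fun x => ?_
      simp only
      rw [← mul_sub, abs_mul, ← mul_add]
      exact mul_le_mul (hB x) (abs_exp_sub_exp_le _ _) (abs_nonneg _)
        ((abs_nonneg _).trans (hB x))
    _ = 2 * B * ∫ x, δ x * Real.exp (u x) ∂μ := by
      rw [integral_const_mul, integral_add (hδ_mul hexp) (hδ_mul hexpT), hδ_comp]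
      ring

end Involution

section Swap

variable {ι κ : Type*} {d : κ → ι}

/-- The involution of the disjoint union of the index sets that exchanges `d j` and `j`. -/
noncomputable def swapIndex (d : κ → ι) : ι ⊕ κ → ι ⊕ κ :=
  Sum.elim (Function.extend d Sum.inr Sum.inl) (Sum.inl ∘ d)

theorem swapIndex_inl_apply (hd : Function.Injective d) (j : κ) :
    swapIndex d (Sum.inl (d j)) = Sum.inr j :=
  hd.extend_apply _ _ j

theorem swapIndex_inl_of_forall_ne {i : ι} (hi : ∀ j, d j ≠ i) :
    swapIndex d (Sum.inl i) = Sum.inl i :=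
  Function.extend_apply' _ _ i fun ⟨j, hj⟩ => hi j hj

theorem swapIndex_involutive (hd : Function.Injective d) : Function.Involutive (swapIndex d) := by
  rintro (i | j)
  · by_cases hi : ∃ j, d j = i
    · obtain ⟨j, rfl⟩ := hi
      rw [swapIndex_inl_apply hd]
      rfl
    · push Not at hi
      rw [swapIndex_inl_of_forall_ne hi, swapIndex_inl_of_forall_ne hi]
  · exact swapIndex_inl_apply hd j

theorem elim_comp_swapIndex (hd : Function.Injective d) (a : ι → ℝ) (s : ι ⊕ κ) :
    Sum.elim a (a ∘ d) (swapIndex d s) = Sum.elim a (a ∘ d) s := by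
  rcases s with i | j
  · by_cases hi : ∃ j, d j = i
    · obtain ⟨j, rfl⟩ := hi
      rw [swapIndex_inl_apply hd]
      rfl
    · push Not at hi
      rw [swapIndex_inl_of_forall_ne hi]
  · rfl

/-- The map that exchanges the coordinates `g (d j)` of the first vector with the second one. -/
noncomputable def swapMap (d : κ → ι) (p : (ι → ℝ) × (κ → ℝ)) : (ι → ℝ) × (κ → ℝ) :=
  (fun i => Sum.elim p.1 p.2 (swapIndex d (Sum.inl i)), p.1 ∘ d)

theorem elim_swapMap (p : (ι → ℝ) × (κ → ℝ)) (s : ι ⊕ κ) :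
    Sum.elim (swapMap d p).1 (swapMap d p).2 s = Sum.elim p.1 p.2 (swapIndex d s) := by
  rcases s with i | j <;> rfl

theorem swapMap_involutive (hd : Function.Injective d) : Function.Involutive (swapMap d) := by
  have helim (p : (ι → ℝ) × (κ → ℝ)) (s : ι ⊕ κ) :
      Sum.elim (swapMap d (swapMap d p)).1 (swapMap d (swapMap d p)).2 s = Sum.elim p.1 p.2 s := by
    rw [elim_swapMap, elim_swapMap, swapIndex_involutive hd]
  exact fun p =>
    Prod.ext (funext fun i => helim p (Sum.inl i)) (funext fun j => helim p (Sum.inr j))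

variable [Fintype ι] [Fintype κ]

theorem quad_swapMap (hd : Function.Injective d) (a : ι → ℝ) (p : (ι → ℝ) × (κ → ℝ)) :
    quad a (swapMap d p).1 + quad (a ∘ d) (p.1 ∘ d) = quad a p.1 + quad (a ∘ d) p.2 := by
  have h := Equiv.sum_comp (swapIndex_involutive hd).toPerm
    fun s => Sum.elim a (a ∘ d) s * Sum.elim p.1 p.2 s ^ 2
  simp only [Function.Involutive.coe_toPerm, elim_comp_swapIndex hd, ← elim_swapMap,
    Fintype.sum_sum_type, Sum.elim_inl, Sum.elim_inr] at h
  exact h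

theorem measurePreserving_swapMap (hd : Function.Injective d) :
    MeasurePreserving (swapMap d)
      ((gaussianPi fun _ : ι => 1).prod (gaussianPi fun _ : κ => 1))
      ((gaussianPi fun _ : ι => 1).prod (gaussianPi fun _ : κ => 1)) := by
  set ν : Measure ℝ := gaussianReal 0 (1 / 1 : ℝ).toNNReal
  set e := (swapIndex_involutive hd).toPerm
  have hsplit := measurePreserving_sumPiEquivProdPi (X := fun _ : ι ⊕ κ => ℝ) fun _ => ν
  have hpermute := measurePreserving_piCongrLeft (α := fun _ : ι ⊕ κ => ℝ) (fun _ => ν) e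
  have hpermute_apply (ω : ι ⊕ κ → ℝ) (s : ι ⊕ κ) :
      MeasurableEquiv.piCongrLeft (fun _ : ι ⊕ κ => ℝ) e ω s = ω (swapIndex d s) := by
    obtain ⟨t, rfl⟩ := e.surjective s
    rw [MeasurableEquiv.coe_piCongrLeft, Equiv.piCongrLeft_apply_apply]
    exact congrArg ω (swapIndex_involutive hd t).symm
  have hswap : swapMap d = (MeasurableEquiv.sumPiEquivProdPi fun _ : ι ⊕ κ => ℝ) ∘
      (MeasurableEquiv.piCongrLeft (fun _ : ι ⊕ κ => ℝ) e) ∘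
      (MeasurableEquiv.sumPiEquivProdPi fun _ : ι ⊕ κ => ℝ).symm := by
    funext p
    have hmerge (s : ι ⊕ κ) :
        (MeasurableEquiv.sumPiEquivProdPi fun _ : ι ⊕ κ => ℝ).symm p s = Sum.elim p.1 p.2 s := by
      rcases s with i | j <;> rfl
    exact Prod.ext (funext fun i => ((hpermute_apply _ (Sum.inl i)).trans (hmerge _)).symm)
      (funext fun j => ((hpermute_apply _ (Sum.inr j)).trans (hmerge _)).symm)
  rw [hswap]
  exact (hsplit.comp hpermute).comp (hsplit.symm _)

end Swap

section Exchange

/-- Exchanging part of a vector, of squared length `r` and energy `a`, for a part of squared length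
`r'` and energy `a'` turns a Rayleigh quotient `x` into `x'`. -/
theorem mul_sub_add_sub_eq {n R R' x x' r r' a a' : ℝ} (hR'₀ : R' ≠ 0) (hR' : R' = R + (r' - r))
    (hx' : x' * R' = x * R + (a' - a)) :
    n * (x' - x) + (r' - r) - (a' - a) =
      (n / R' - 1) * ((a' - a) - x * (r' - r)) + (1 - x) * (r' - r) := by
  have hdiff : (a' - a) - x * (r' - r) = (x' - x) * R' := by linear_combination -hx' + x * hR'
  have hcancel : (n / R' - 1) * ((x' - x) * R') = (n - R') * (x' - x) := by field_simp
  rw [hdiff, hcancel]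
  linear_combination hx' - x * hR'

theorem min_one_abs_exchange_le {n R R' x x' r r' a a' M : ℝ} (hn : 0 < n) (hM : 1 ≤ M)
    (hx : x ∈ Icc 0 M) (hr : 0 ≤ r) (hr' : 0 ≤ r') (ha : a ∈ Icc 0 (M * r))
    (ha' : a' ∈ Icc 0 (M * r')) (hR' : R' = R + (r' - r))
    (hx' : x' * R' = x * R + (a' - a)) :
    min 1 |(n * (x' - x) + (r' - r) - (a' - a)) / 2| ≤
      (1 + (r + r')) * (2 * M * (|R - n| / n) + |x - 1|) +
        2 * M * (1 / n) * (1 + (r + r')) ^ 2 := by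
  set s := r + r'
  set e := 2 * (|R - n| + s) / n
  have hs : 0 ≤ s := add_nonneg hr hr'
  have : 0 ≤ e := by positivity
  have hr_sub : |r' - r| ≤ s := abs_sub_le_iff.2 ⟨by linarith, by linarith⟩
  have hR_sub : |R' - n| ≤ |R - n| + s := by
    rw [show R' - n = (R - n) + (r' - r) by rw [hR']; ring]
    exact (abs_add_le _ _).trans (add_le_add_right hr_sub _)
  have hmain : min 1 |(n * (x' - x) + (r' - r) - (a' - a)) / 2| ≤
      e * (M * (1 + s)) + |x - 1| * s := by
    rcases lt_or_ge R' (n / 2) with hlt | hge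
    · have he_one : 1 ≤ e := by
        rw [one_le_div hn]
        linarith [neg_abs_le (R' - n)]
      refine (min_le_left _ _).trans (le_add_of_le_of_nonneg ?_ (by positivity))
      exact one_le_mul_of_one_le_of_one_le he_one
        (one_le_mul_of_one_le_of_one_le hM (le_add_of_nonneg_right hs))
    · have hR'₀ : 0 < R' := (half_pos hn).trans_le hge
      have hratio : |n / R' - 1| ≤ e := by
        rw [div_sub_one hR'₀.ne', abs_div, abs_of_pos hR'₀, abs_sub_comm]
        calc |R' - n| / R' ≤ (|R - n| + s) / (n / 2) := by gcongr
          _ = e := by rw [div_div_eq_mul_div, mul_comm _ 2]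
      have henergy : |(a' - a) - x * (r' - r)| ≤ M * s := by
        have hxr := mul_le_mul_of_nonneg_right hx.2 hr
        have hxr' := mul_le_mul_of_nonneg_right hx.2 hr'
        have hxr₀ := mul_nonneg hx.1 hr
        have hxr'₀ := mul_nonneg hx.1 hr'
        exact abs_le.2 ⟨by linarith [ha.2, ha'.1], by linarith [ha.1, ha'.2]⟩
      refine (min_le_right _ _).trans ?_
      rw [abs_div, abs_two, mul_sub_add_sub_eq hR'₀.ne' hR' hx']
      refine (half_le_self (abs_nonneg _)).trans ((abs_add_le _ _).trans ?_)
      rw [abs_mul, abs_mul, abs_sub_comm 1 x]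
      gcongr
      exact henergy.trans (by gcongr; linarith)
  calc _ ≤ 2 * (|R - n| + s) / n * (M * (1 + s)) + |x - 1| * s := hmain
    _ ≤ 2 * (|R - n| + (1 + s)) / n * (M * (1 + s)) + |x - 1| * (1 + s) := by
      gcongr <;> exact le_add_of_nonneg_left zero_le_one
    _ = _ := by ring

theorem mul_le_half_mul_sq_add_sq_div {t : ℝ} (ht : 0 < t) (w y : ℝ) :
    w * y ≤ (t * w ^ 2 + y ^ 2 / t) / 2 := by
  have hsq : t * w ^ 2 + y ^ 2 / t - 2 * (w * y) = (t * w - y) ^ 2 / t := by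
    field_simp
    ring
  linarith [div_nonneg (sq_nonneg (t * w - y)) ht.le]

theorem exchange_error_le {n z w R x M t : ℝ} (hM : 0 ≤ M) (ht : 0 < t) (hnt : 1 / n ≤ t)
    (hz : z ≤ w * (2 * M * (|R - n| / n) + |x - 1|) + 2 * M * (1 / n) * w ^ 2) :
    z ≤ (2 * M + 1) * t * w ^ 2 + 4 * M ^ 2 / n ^ 2 / t * (R - n) ^ 2 + 1 / t * (x - 1) ^ 2 := by
  have hamgm := mul_le_half_mul_sq_add_sq_div ht w (2 * M * (|R - n| / n) + |x - 1|)
  have hsq : (2 * M * (|R - n| / n) + |x - 1|) ^ 2 ≤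
      8 * M ^ 2 / n ^ 2 * (R - n) ^ 2 + 2 * (x - 1) ^ 2 := by
    refine (add_sq_le (R := ℝ)).trans_eq ?_
    rw [mul_pow, div_pow, sq_abs, sq_abs]
    ring
  calc z
    _ ≤ (t * w ^ 2 + (8 * M ^ 2 / n ^ 2 * (R - n) ^ 2 + 2 * (x - 1) ^ 2) / t) / 2 +
          2 * M * t * w ^ 2 := by
      refine hz.trans (add_le_add (hamgm.trans ?_) ?_) <;> gcongr
    _ = (2 * M + 1 / 2) * t * w ^ 2 + 4 * M ^ 2 / n ^ 2 / t * (R - n) ^ 2 +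
          1 / t * (x - 1) ^ 2 := by ring
    _ ≤ _ := by gcongr; norm_num

variable {ι κ : Type*} [Fintype ι] [Fintype κ] {L : ι → ℝ} {d : κ → ι}

theorem sq_quad_one_le (x : κ → ℝ) :
    quad (fun _ => 1) x ^ 2 ≤ Fintype.card κ * ∑ j, x j ^ 4 := by
  have hcs := sq_sum_le_card_mul_sum_sq (s := Finset.univ) (f := fun j => x j ^ 2)
  simpa only [quad, one_mul, ← pow_mul, Finset.card_univ] using hcs

theorem sq_one_add_quad_one_le (x y : κ → ℝ) :
    (1 + (quad (fun _ => 1) x + quad (fun _ => 1) y)) ^ 2 ≤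
      3 * (1 + Fintype.card κ * ∑ j, (x j ^ 4 + y j ^ 4)) := by
  have hsq : ∀ u v : ℝ, (1 + (u + v)) ^ 2 ≤ 3 * (1 + (u ^ 2 + v ^ 2)) := fun u v => by
    linarith [sq_nonneg (u - v), sq_nonneg (u - 1), sq_nonneg (v - 1)]
  rw [Finset.sum_add_distrib, mul_add (Fintype.card κ : ℝ)]
  exact (hsq _ _).trans (mul_le_mul_of_nonneg_left (add_le_add_right
    (add_le_add (sq_quad_one_le x) (sq_quad_one_le y)) 1) zero_le_three)

/-- The log-density of `(rayleighGibbs L).prod (gaussianPi (L ∘ d))` with respect to the standard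
normal measure. -/
noncomputable def exchangeExponent (L : ι → ℝ) (d : κ → ι) (p : (ι → ℝ) × (κ → ℝ)) : ℝ :=
  -(Fintype.card ι * rayleigh L p.1 / 2) + (quad (fun _ => 1) p.2 - quad (L ∘ d) p.2) / 2

@[fun_prop]
theorem measurable_exchangeExponent (L : ι → ℝ) (d : κ → ι) :
    Measurable (exchangeExponent L d) := by
  unfold exchangeExponent
  fun_prop

theorem integrable_exp_exchangeExponent (hL : ∀ i, 0 < L i) :
    Integrable (fun p => Real.exp (exchangeExponent L d p))
      ((gaussianPi fun _ : ι => 1).prod (gaussianPi fun _ : κ => 1)) := by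
  simp only [exchangeExponent, Real.exp_add]
  exact (integrable_exp_of_bounded (by fun_prop)
    (neg_card_mul_rayleigh_nonpos fun i => (hL i).le)).mul_prod
      (integrable_exp_quad_sub (fun _ => one_pos) fun j => hL (d j))

theorem rayleighGibbs_prod_gaussianPi (hL : ∀ i, 0 < L i) :
    (rayleighGibbs L).prod (gaussianPi (L ∘ d)) =
      ((gaussianPi fun _ => 1).prod (gaussianPi fun _ => 1)).tilted (exchangeExponent L d) := by
  rw [rayleighGibbs, ← gaussianPi_tilted (l := fun _ : κ => 1) (fun _ => one_pos)
    (l' := L ∘ d) fun j => hL (d j)]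
  exact prod_tilted (by fun_prop) (by fun_prop)

theorem quad_mem_Icc_of_forall_le {l : κ → ℝ} {M : ℝ} (hl : ∀ j, 0 ≤ l j) (hlM : ∀ j, l j ≤ M)
    (x : κ → ℝ) : quad l x ∈ Icc 0 (M * quad (fun _ => 1) x) :=
  ⟨quad_nonneg hl x, quad_const M x ▸ quad_mono hlM x⟩

theorem integrable_sum_pow_four (hL : ∀ i, 0 ≤ L i) :
    Integrable (fun p : (ι → ℝ) × (κ → ℝ) => ∑ j, (p.1 (d j) ^ 4 + p.2 j ^ 4))
      ((rayleighGibbs L).prod (gaussianPi (L ∘ d))) := by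
  have := isProbabilityMeasure_rayleighGibbs hL
  exact integrable_finsetSum _ fun j _ =>
    ((integrable_rayleighGibbs hL (integrable_pow_gaussianPi _ 4 (d j))).comp_fst _).add
      ((integrable_pow_gaussianPi _ 4 j).comp_snd _)

theorem integral_sum_pow_four_le {C : ℝ} (hL : ∀ i, 0 ≤ L i)
    (hC : ∀ i, ∫ g, g i ^ 4 ∂(rayleighGibbs L) ≤ C)
    (hC' : ∀ j, ∫ x, x j ^ 4 ∂(gaussianPi (L ∘ d)) ≤ C) :
    ∫ p, ∑ j, (p.1 (d j) ^ 4 + p.2 j ^ 4) ∂((rayleighGibbs L).prod (gaussianPi (L ∘ d))) ≤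
      Fintype.card κ * (2 * C) := by
  have := isProbabilityMeasure_rayleighGibbs hL
  have hfst := fun j => (integrable_rayleighGibbs hL
    (integrable_pow_gaussianPi _ 4 (d j))).comp_fst (gaussianPi (L ∘ d))
  have hsnd := fun j => (integrable_pow_gaussianPi (L ∘ d) 4 j).comp_snd (rayleighGibbs L)
  rw [integral_finsetSum _ fun j _ => by exact (hfst j).add (hsnd j)]
  refine (Finset.sum_le_card_nsmul _ _ (2 * C) fun j _ => ?_).trans_eq (nsmul_eq_mul _ _)
  rw [integral_add (hfst j) (hsnd j), two_mul]
  refine add_le_add (le_of_eq_of_le ?_ (hC (d j))) (le_of_eq_of_le ?_ (hC' j))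
  · rw [integral_fun_fst fun g : ι → ℝ => g (d j) ^ 4, probReal_univ, one_smul]
  · rw [integral_fun_snd fun x : κ → ℝ => x j ^ 4, probReal_univ, one_smul]

variable {M t : ℝ}

theorem integrable_sq_rayleigh_sub_one (hL : ∀ i, 0 ≤ L i) (hLM : ∀ i, L i ≤ M) (hM : 1 ≤ M) :
    Integrable (fun g => (rayleigh L g - 1) ^ 2) (rayleighGibbs L) := by
  have := isProbabilityMeasure_rayleighGibbs hL
  refine Integrable.of_bound (by fun_prop) (M ^ 2) (ae_of_all _ fun g => ?_)
  have hx₀ := rayleigh_nonneg hL g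
  have hxM := rayleigh_le (zero_le_one.trans hM) hLM g
  rw [Real.norm_eq_abs, abs_of_nonneg (sq_nonneg _)]
  exact sq_le_sq' (by linarith) (by linarith)

variable [Nonempty ι]

theorem min_one_abs_exchangeExponent_sub_swapMap_le (hd : Function.Injective d)
    (hL : ∀ i, 0 ≤ L i) (hLM : ∀ i, L i ≤ M) (hM : 1 ≤ M) (ht : 0 < t)
    (hnt : 1 / (Fintype.card ι : ℝ) ≤ t) (p : (ι → ℝ) × (κ → ℝ)) :
    min 1 |exchangeExponent L d p - exchangeExponent L d (swapMap d p)| ≤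
      (2 * M + 1) * t * (3 * (1 + Fintype.card κ * ∑ j, (p.1 (d j) ^ 4 + p.2 j ^ 4))) +
        4 * M ^ 2 / Fintype.card ι ^ 2 / t * (quad (fun _ => 1) p.1 - Fintype.card ι) ^ 2 +
        1 / t * (rayleigh L p.1 - 1) ^ 2 := by
  have hM₀ : 0 ≤ M := zero_le_one.trans hM
  have hn : 0 < (Fintype.card ι : ℝ) := Nat.cast_pos.2 Fintype.card_pos
  have hexponent : exchangeExponent L d p - exchangeExponent L d (swapMap d p) =
      (Fintype.card ι * (rayleigh L (swapMap d p).1 - rayleigh L p.1) +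
        (quad (fun _ => 1) p.2 - quad (fun _ => 1) (p.1 ∘ d)) -
        (quad (L ∘ d) p.2 - quad (L ∘ d) (p.1 ∘ d))) / 2 := by
    simp only [exchangeExponent, swapMap]
    ring
  have hlength : quad (fun _ => 1) (swapMap d p).1 + quad (fun _ => 1) (p.1 ∘ d) =
      quad (fun _ => 1) p.1 + quad (fun _ => 1) p.2 := quad_swapMap hd (fun _ => 1) p
  have henergy := quad_swapMap hd L p
  have hbound := min_one_abs_exchange_le hn hM
    ⟨rayleigh_nonneg hL p.1, rayleigh_le hM₀ hLM p.1⟩ (quad_one_nonneg (p.1 ∘ d))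
    (quad_one_nonneg p.2)
    (quad_mem_Icc_of_forall_le (l := L ∘ d) (fun j => hL (d j)) (fun j => hLM (d j)) _)
    (quad_mem_Icc_of_forall_le (l := L ∘ d) (fun j => hL (d j)) (fun j => hLM (d j)) p.2)
    (R := quad (fun _ => 1) p.1) (R' := quad (fun _ => 1) (swapMap d p).1)
    (by linear_combination hlength)
    (by rw [rayleigh_mul_quad_one, rayleigh_mul_quad_one]; linear_combination henergy)
  rw [hexponent]
  refine (exchange_error_le hM₀ ht hnt hbound).trans ?_
  gcongr
  exact sq_one_add_quad_one_le (p.1 ∘ d) p.2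

theorem le_of_le_one_of_le_sq {x y : ℝ} (hx₀ : 0 ≤ x) (hx₁ : x ≤ 1) (hy : 0 ≤ y)
    (hxy : x ≤ y ^ 2) : x ≤ y :=
  (pow_le_pow_iff_left₀ hx₀ hy two_ne_zero).1 ((pow_le_of_le_one hx₀ hx₁ two_ne_zero).trans hxy)

theorem integral_min_one_abs_exchangeExponent_sub_swapMap_le_moments (hd : Function.Injective d)
    (hL : ∀ i, 0 ≤ L i) (hLM : ∀ i, L i ≤ M) (hM : 1 ≤ M) (ht : 0 < t)
    (hnt : 1 / (Fintype.card ι : ℝ) ≤ t) :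
    ∫ p, min 1 |exchangeExponent L d p - exchangeExponent L d (swapMap d p)|
        ∂((rayleighGibbs L).prod (gaussianPi (L ∘ d))) ≤
      (2 * M + 1) * t * (3 * (1 + Fintype.card κ *
          ∫ p, ∑ j, (p.1 (d j) ^ 4 + p.2 j ^ 4) ∂((rayleighGibbs L).prod (gaussianPi (L ∘ d))))) +
        4 * M ^ 2 / Fintype.card ι ^ 2 / t *
          ∫ g, (quad (fun _ => 1) g - Fintype.card ι) ^ 2 ∂(rayleighGibbs L) +
        1 / t * ∫ g, (rayleigh L g - 1) ^ 2 ∂(rayleighGibbs L) := by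
  have := isProbabilityMeasure_rayleighGibbs hL
  have hfourth := integrable_sum_pow_four (d := d) hL
  have hlength := (integrable_rayleighGibbs hL ((memLp_quad_gaussianPi (fun _ => 1)
    fun _ => 1).sub (memLp_const (Fintype.card ι : ℝ))).integrable_sq).comp_fst (gaussianPi (L ∘ d))
  have henergy := (integrable_sq_rayleigh_sub_one hL hLM hM).comp_fst (gaussianPi (L ∘ d))
  refine (integral_mono_of_nonneg (ae_of_all _ fun p => by positivity) (by fun_prop)
    (ae_of_all _ <| min_one_abs_exchangeExponent_sub_swapMap_le hd hL hLM hM ht hnt)).trans_eq ?_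
  rw [integral_add (by fun_prop) (by fun_prop), integral_add (by fun_prop) (by fun_prop),
    integral_const_mul, integral_const_mul, integral_const_mul, integral_const_mul,
    integral_add (by fun_prop) (by fun_prop), integral_const_mul, integral_const,
    integral_fun_fst fun g : ι → ℝ => (quad (fun _ => 1) g - Fintype.card ι) ^ 2,
    integral_fun_fst fun g : ι → ℝ => (rayleigh L g - 1) ^ 2]
  simp only [probReal_univ, one_smul]

/-- The constant in the comparison of `k`-point marginals with their Gaussian limits, when the
weights are at most `M` and the fourth moments at most `C`. -/
noncomputable def exchangeConst (M C : ℝ) (k : ℕ) : ℝ :=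
  3 * (2 * M + 1) * (1 + 2 * (k : ℝ) ^ 2 * C) + 4 * M ^ 2 * normalFourthMoment + 1

theorem integral_min_one_abs_exchangeExponent_sub_swapMap_le {C : ℝ}
    (hd : Function.Injective d) (hL : ∀ i, 0 ≤ L i) (hLM : ∀ i, L i ≤ M) (hM : 1 ≤ M)
    (ht : 0 < t) (hnt : 1 / (Fintype.card ι : ℝ) ≤ t ^ 2)
    (hx : ∫ g, (rayleigh L g - 1) ^ 2 ∂(rayleighGibbs L) ≤ t ^ 2)
    (hC : ∀ i, ∫ g, g i ^ 4 ∂(rayleighGibbs L) ≤ C)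
    (hC' : ∀ j, ∫ x, x j ^ 4 ∂(gaussianPi (L ∘ d)) ≤ C) :
    ∫ p, min 1 |exchangeExponent L d p - exchangeExponent L d (swapMap d p)|
        ∂((rayleighGibbs L).prod (gaussianPi (L ∘ d))) ≤
      exchangeConst M C (Fintype.card κ) * t := by
  have hn : 1 ≤ (Fintype.card ι : ℝ) := Nat.one_le_cast.2 Fintype.card_pos
  have hnt' : 1 / (Fintype.card ι : ℝ) ≤ t :=
    le_of_le_one_of_le_sq (by positivity) ((div_le_one (by positivity)).2 hn) ht.le hnt
  have := normalFourthMoment_nonneg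
  calc ∫ p, min 1 |exchangeExponent L d p - exchangeExponent L d (swapMap d p)|
        ∂((rayleighGibbs L).prod (gaussianPi (L ∘ d)))
    _ ≤ (2 * M + 1) * t * (3 * (1 + Fintype.card κ * (Fintype.card κ * (2 * C)))) +
          4 * M ^ 2 / Fintype.card ι ^ 2 / t * (normalFourthMoment * Fintype.card ι) +
          1 / t * t ^ 2 := by
      refine (integral_min_one_abs_exchangeExponent_sub_swapMap_le_moments hd hL hLM hM ht
        hnt').trans ?_
      gcongr
      · exact integral_sum_pow_four_le hL hC hC'
      · exact integral_sq_quad_one_sub_card_rayleighGibbs_le hL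
    _ = 3 * (2 * M + 1) * (1 + 2 * Fintype.card κ ^ 2 * C) * t +
          4 * M ^ 2 * normalFourthMoment * (1 / Fintype.card ι / t) + t := by
      field_simp
    _ ≤ 3 * (2 * M + 1) * (1 + 2 * Fintype.card κ ^ 2 * C) * t +
          4 * M ^ 2 * normalFourthMoment * t + t := by
      gcongr
      exact (div_le_iff₀ ht).2 (hnt.trans_eq (sq t))
    _ = exchangeConst M C (Fintype.card κ) * t := by rw [exchangeConst]; ring

theorem abs_integral_rayleighGibbs_sub_le {B C : ℝ} {f : (κ → ℝ) → ℝ}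
    (hd : Function.Injective d) (hL : ∀ i, 0 < L i) (hLM : ∀ i, L i ≤ M) (hM : 1 ≤ M)
    (ht : 0 < t) (hnt : 1 / (Fintype.card ι : ℝ) ≤ t ^ 2)
    (hx : ∫ g, (rayleigh L g - 1) ^ 2 ∂(rayleighGibbs L) ≤ t ^ 2)
    (hC : ∀ i, ∫ g, g i ^ 4 ∂(rayleighGibbs L) ≤ C)
    (hC' : ∀ j, ∫ x, x j ^ 4 ∂(gaussianPi (L ∘ d)) ≤ C) (hf : Measurable f)
    (hB : ∀ x, |f x| ≤ B) :
    |∫ g, f (g ∘ d) ∂(rayleighGibbs L) - ∫ x, f x ∂(gaussianPi (L ∘ d))| ≤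
      2 * B * (exchangeConst M C (Fintype.card κ) * t) := by
  have := isProbabilityMeasure_rayleighGibbs fun i => (hL i).le
  have hB₀ : 0 ≤ B := (abs_nonneg _).trans (hB 0)
  have hswap := abs_integral_tilted_sub_comp_le (measurePreserving_swapMap hd)
    (swapMap_involutive hd) (by fun_prop) (integrable_exp_exchangeExponent (d := d) hL)
    (f := fun p => f p.2) (by fun_prop) (fun p => hB p.2)
  rw [← rayleighGibbs_prod_gaussianPi hL] at hswap
  have hsnd := integral_fun_snd (μ := rayleighGibbs L) (ν := gaussianPi (L ∘ d)) f
  have hfst := integral_fun_fst (μ := rayleighGibbs L) (ν := gaussianPi (L ∘ d))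
    fun g => f (g ∘ d)
  rw [probReal_univ, one_smul] at hsnd hfst
  rw [← hsnd, ← hfst, abs_sub_comm]
  refine hswap.trans (mul_le_mul_of_nonneg_left ?_ (by positivity))
  exact integral_min_one_abs_exchangeExponent_sub_swapMap_le hd (fun i => (hL i).le) hLM hM ht hnt
    hx hC hC'

end Exchange

section Saddle

/-- The weights `1 + 2θ(v - c i)` of the quadratic form that describes the Gibbs measure at energy
level `v`; at the limiting energy they are the inverse variances of the limiting marginals. -/
noncomputable def saddleWeight {ι : Type*} (θ v : ℝ) (c : ι → ℝ) (i : ι) : ℝ :=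
  1 + 2 * θ * (v - c i)

theorem pi_marginalLaw_eq_gaussianPi {κ : Type*} [Fintype κ] (ρ : Measure ℝ) (b θ : ℝ)
    (x : κ → ℝ) : Measure.pi (fun j => marginalLaw ρ b θ (x j)) =
      gaussianPi (saddleWeight θ (limitEnergy ρ b θ) x) :=
  rfl

theorem saddleWeight_eq {ι : Type*} (θ v : ℝ) (c : ι → ℝ) :
    saddleWeight θ v c = fun i => -(2 * θ) * c i + (1 + 2 * θ * v) := by
  funext i
  rw [saddleWeight]
  ring

variable {N : ℕ} {c : Fin N → ℝ} {θ v w : ℝ}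

theorem hamiltonian_eq_mul_rayleigh (c g : Fin N → ℝ) : hamiltonian c g = N * rayleigh c g := by
  simp only [hamiltonian, rayleigh, quad, one_mul, Finset.sum_div, mul_div_assoc]

theorem rayleigh_saddleWeight_sub_one {g : Fin N → ℝ} (hg : g ≠ 0) :
    rayleigh (saddleWeight θ v c) g - 1 = 2 * θ * (v - rayleigh c g) := by
  rw [saddleWeight_eq, rayleigh_add_const hg, rayleigh_const_mul]
  ring

variable [NeZero N]

theorem energy_eq_rayleigh (c g : Fin N → ℝ) : energy c g = rayleigh c g := by
  rw [energy, hamiltonian_eq_mul_rayleigh, mul_div_cancel_left₀ _ (NeZero.ne (N : ℝ))]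

theorem gibbsMean_eq_integral_rayleighGibbs (c : Fin N → ℝ) (θ v : ℝ) (f : (Fin N → ℝ) → ℝ) :
    gibbsMean c θ f = ∫ g, f g ∂(rayleighGibbs (saddleWeight θ v c)) := by
  have hexponent : (fun g => -(Fintype.card (Fin N) * rayleigh (fun i => -(2 * θ) * c i) g / 2)) =
      fun g => θ * hamiltonian c g := by
    funext g
    rw [rayleigh_const_mul, hamiltonian_eq_mul_rayleigh, Fintype.card_fin]
    ring
  rw [saddleWeight_eq, rayleighGibbs_add_const, rayleighGibbs, hexponent, integral_tilted_eq_div,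
    gibbsMean, partitionFunction, stdNormal_eq_gaussianPi, one_div, inv_mul_eq_div]

theorem abs_gibbsMean_le {f : (Fin N → ℝ) → ℝ} {B : ℝ} (hl : ∀ i, 0 ≤ saddleWeight θ v c i)
    (hB : ∀ g, |f g| ≤ B) : |gibbsMean c θ f| ≤ B := by
  have := isProbabilityMeasure_rayleighGibbs hl
  rw [gibbsMean_eq_integral_rayleighGibbs c θ v, ← Real.norm_eq_abs]
  simpa using norm_integral_le_of_norm_le_const (f := f) (C := B)
    (μ := rayleighGibbs (saddleWeight θ v c)) (ae_of_all _ hB)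

theorem ae_ne_zero_rayleighGibbs {ι : Type*} [Fintype ι] [Nonempty ι] (l : ι → ℝ) :
    ∀ᵐ g ∂(rayleighGibbs l), g ≠ 0 :=
  (tilted_absolutelyContinuous _ _).ae_le (ae_ne_zero_gaussianPi fun _ => one_pos)

theorem integral_sq_rayleigh_saddleWeight_sub_one :
    ∫ g, (rayleigh (saddleWeight θ v c) g - 1) ^ 2 ∂(rayleighGibbs (saddleWeight θ v c)) =
      (2 * θ) ^ 2 * gibbsMean c θ fun g => (energy c g - v) ^ 2 := by
  rw [gibbsMean_eq_integral_rayleighGibbs c θ v, ← integral_const_mul]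
  refine integral_congr_ae ?_
  filter_upwards [ae_ne_zero_rayleighGibbs _] with g hg
  rw [rayleigh_saddleWeight_sub_one hg, energy_eq_rayleigh]
  ring

theorem gibbsMean_sq_energy_sub_le {b : ℝ} (hb : 0 ≤ b) (hc : ∀ i, c i ∈ Icc 0 b)
    (hl : ∀ i, 0 ≤ saddleWeight θ w c i) :
    (gibbsMean c θ fun g => (energy c g - v) ^ 2) ≤
      2 * (gibbsMean c θ fun g => (energy c g - w) ^ 2) + 2 * (w - v) ^ 2 := by
  have := isProbabilityMeasure_rayleighGibbs hl
  simp only [gibbsMean_eq_integral_rayleighGibbs c θ w, energy_eq_rayleigh]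
  have hint :
      Integrable (fun g => (rayleigh c g - w) ^ 2) (rayleighGibbs (saddleWeight θ w c)) := by
    refine Integrable.of_bound (by fun_prop) ((b + |w|) ^ 2) (ae_of_all _ fun g => ?_)
    have hx₀ := rayleigh_nonneg (fun i => (hc i).1) g
    have hxb := rayleigh_le hb (fun i => (hc i).2) g
    rw [norm_pow]
    gcongr
    exact (norm_sub_le _ _).trans (add_le_add ((Real.norm_of_nonneg hx₀).trans_le hxb) le_rfl)
  calc ∫ g, (rayleigh c g - v) ^ 2 ∂(rayleighGibbs (saddleWeight θ w c))
    _ ≤ ∫ g, (2 * (rayleigh c g - w) ^ 2 + 2 * (w - v) ^ 2)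
          ∂(rayleighGibbs (saddleWeight θ w c)) := by
      refine integral_mono_of_nonneg (ae_of_all _ fun g => sq_nonneg _)
        ((hint.const_mul 2).add (integrable_const _)) (ae_of_all _ fun g => ?_)
      have := add_sq_le (a := rayleigh c g - w) (b := w - v)
      rwa [sub_add_sub_cancel, mul_add] at this
    _ = _ := by
      rw [integral_add (hint.const_mul 2) (integrable_const _), integral_const_mul, integral_const,
        probReal_univ, one_smul]

end Saddle

section Rate

variable {N : ℕ} {ρ : Measure ℝ} {b θ : ℝ} {c : Fin N → ℝ}

theorem energyError_nonneg : 0 ≤ energyError ρ b θ c :=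
  mul_nonneg (one_div_nonneg.2 (integral_nonneg fun _ => (Real.exp_pos _).le))
    (integral_nonneg fun _ => mul_nonneg (sq_nonneg _) (Real.exp_pos _).le)

theorem one_div_sqrt_le_rate : 1 / √(N : ℝ) ≤ rate ρ b θ c :=
  le_add_of_nonneg_right (Real.sqrt_nonneg _)

theorem energyError_le_sq_rate : energyError ρ b θ c ≤ rate ρ b θ c ^ 2 := by
  have hle : √(energyError ρ b θ c) ≤ rate ρ b θ c := le_add_of_nonneg_left (by positivity)
  calc energyError ρ b θ c
    _ = √(energyError ρ b θ c) ^ 2 := (Real.sq_sqrt energyError_nonneg).symm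
    _ ≤ rate ρ b θ c ^ 2 := by gcongr

theorem one_div_le_sq_rate : 1 / (N : ℝ) ≤ rate ρ b θ c ^ 2 := by
  calc 1 / (N : ℝ)
    _ = (1 / √(N : ℝ)) ^ 2 := by rw [div_pow, one_pow, Real.sq_sqrt N.cast_nonneg]
    _ ≤ rate ρ b θ c ^ 2 := by
      gcongr
      exact one_div_sqrt_le_rate

variable [NeZero N]

theorem rate_pos : 0 < rate ρ b θ c :=
  (one_div_pos.2 (Real.sqrt_pos.2 (Nat.cast_pos.2 (NeZero.pos N)))).trans_le one_div_sqrt_le_rate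

theorem one_le_sqrt_mul_rate {n : ℕ} (hn : N ≤ n) : 1 ≤ √(n : ℝ) * rate ρ b θ c := by
  calc (1 : ℝ)
    _ = √(N : ℝ) * (1 / √(N : ℝ)) :=
      (mul_one_div_cancel (Real.sqrt_pos.2 (Nat.cast_pos.2 (NeZero.pos N))).ne').symm
    _ ≤ √(n : ℝ) * rate ρ b θ c := by
      gcongr
      exact one_div_sqrt_le_rate

end Rate

section Marginals

variable {N k : ℕ} [NeZero N] {ρ : Measure ℝ} {b θ B : ℝ} {c : Fin N → ℝ} {d : Fin k → Fin N}
  {f : (Fin k → ℝ) → ℝ}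

theorem abs_gibbsMean_sub_le_two_mul
    (hl : ∀ i, 0 ≤ saddleWeight θ (limitEnergy ρ b θ) c i) (hB : ∀ x, |f x| ≤ B) :
    |gibbsMean c θ (fun g => f fun i => g (d i)) -
        ∫ x, f x ∂(Measure.pi fun i => marginalLaw ρ b θ (c (d i)))| ≤ 2 * B := by
  have hgauss : |∫ x, f x ∂(Measure.pi fun i => marginalLaw ρ b θ (c (d i)))| ≤ B := by
    rw [pi_marginalLaw_eq_gaussianPi, ← Real.norm_eq_abs]
    simpa using norm_integral_le_of_norm_le_const (f := f) (C := B)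
      (μ := gaussianPi (saddleWeight θ (limitEnergy ρ b θ) fun i => c (d i))) (ae_of_all _ hB)
  rw [two_mul]
  exact (abs_sub _ _).trans (add_le_add (abs_gibbsMean_le hl fun _ => hB _) hgauss)

theorem abs_gibbsMean_sub_le_mul_rate {m M C : ℝ} (hm : 0 < m) (hM : 1 ≤ M)
    (hl : ∀ i, saddleWeight θ (limitEnergy ρ b θ) c i ∈ Icc m M)
    (hC : ∀ i, gibbsMean c θ (fun g => g i ^ 4) ≤ C) (hd : Function.Injective d)
    (hf : Measurable f) (hB : ∀ x, |f x| ≤ B) :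
    |gibbsMean c θ (fun g => f fun i => g (d i)) -
        ∫ x, f x ∂(Measure.pi fun i => marginalLaw ρ b θ (c (d i)))| ≤
      2 * exchangeConst M (max C (normalFourthMoment / m ^ 2)) k * (1 + 2 * |θ|) * B *
        rate ρ b θ c := by
  set L := saddleWeight θ (limitEnergy ρ b θ) c
  have hL (i : Fin N) : 0 < L i := hm.trans_le (hl i).1
  have ht : 0 < (1 + 2 * |θ|) * rate ρ b θ c := mul_pos (by positivity) rate_pos
  have hcard : 1 / (Fintype.card (Fin N) : ℝ) ≤ ((1 + 2 * |θ|) * rate ρ b θ c) ^ 2 := by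
    rw [Fintype.card_fin, mul_pow]
    exact one_div_le_sq_rate.trans (le_mul_of_one_le_left (sq_nonneg _)
      (one_le_pow₀ (le_add_of_nonneg_right (by positivity))))
  have hvar : ∫ g, (rayleigh L g - 1) ^ 2 ∂(rayleighGibbs L) ≤
      ((1 + 2 * |θ|) * rate ρ b θ c) ^ 2 := by
    calc ∫ g, (rayleigh L g - 1) ^ 2 ∂(rayleighGibbs L)
      _ = (2 * |θ|) ^ 2 * energyError ρ b θ c := by
        rw [integral_sq_rayleigh_saddleWeight_sub_one, mul_pow, mul_pow, sq_abs, energyError]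
      _ ≤ (1 + 2 * |θ|) ^ 2 * rate ρ b θ c ^ 2 := by
        gcongr
        · exact energyError_nonneg
        · exact le_add_of_nonneg_left zero_le_one
        · exact energyError_le_sq_rate
      _ = ((1 + 2 * |θ|) * rate ρ b θ c) ^ 2 := (mul_pow _ _ _).symm
  have hgauss (j : Fin k) : ∫ x, x j ^ 4 ∂(gaussianPi (L ∘ d)) ≤ normalFourthMoment / m ^ 2 := by
    rw [integral_pow_four_gaussianPi (l := L ∘ d) fun j => hL (d j)]
    have := normalFourthMoment_nonneg
    gcongr
    exact (hl (d j)).1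
  have hmain := abs_integral_rayleighGibbs_sub_le hd hL (fun i => (hl i).2) hM ht hcard hvar
    (C := max C (normalFourthMoment / m ^ 2)) (fun i => le_max_of_le_left
      ((gibbsMean_eq_integral_rayleighGibbs c θ _ _).symm.trans_le (hC i)))
    (fun j => le_max_of_le_right (hgauss j)) hf hB
  rw [gibbsMean_eq_integral_rayleighGibbs c θ (limitEnergy ρ b θ), pi_marginalLaw_eq_gaussianPi]
  rw [Fintype.card_fin] at hmain
  refine hmain.trans_eq ?_
  ring

end Marginals

section Limit

variable {b θ : ℝ} {γ : (N : ℕ) → Fin N → ℝ} {ρ : Measure ℝ}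

theorem exists_forall_abs_sub_lt_imp_mem_Icc {v : ℝ} (hb : 0 ≤ b)
    (hpos : ∀ x ∈ Icc 0 b, 0 < 1 + 2 * θ * (v - x)) :
    ∃ m M δ : ℝ, 0 < m ∧ 1 ≤ M ∧ 0 < δ ∧
      ∀ w, |w - v| < δ → ∀ x ∈ Icc 0 b, 1 + 2 * θ * (w - x) ∈ Icc m M := by
  obtain ⟨x₀, hx₀, hmin⟩ := isCompact_Icc.exists_isMinOn (nonempty_Icc.2 hb)
    (f := fun x => 1 + 2 * θ * (v - x)) (by fun_prop)
  set m := (1 + 2 * θ * (v - x₀)) / 2 with hm_def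
  have hm : 0 < m := half_pos (hpos x₀ hx₀)
  set δ := m / (2 * |θ| + 1)
  have hδ : 0 < δ := by positivity
  have hδm : 2 * |θ| * δ ≤ m := by
    rw [mul_div_assoc', div_le_iff₀ (by positivity)]
    nlinarith
  refine ⟨m, 1 + 2 * |θ| * (δ + |v| + b), δ, hm, le_add_of_nonneg_right (by positivity), hδ,
    fun w hw x hx => ⟨?_, ?_⟩⟩
  · have hshift : |2 * θ * (w - v)| ≤ m := by
      rw [abs_mul, abs_mul, abs_two]
      exact (mul_le_mul_of_nonneg_left hw.le (by positivity)).trans hδm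
    have hle : 2 * m ≤ 1 + 2 * θ * (v - x) := by
      rw [hm_def, mul_div_cancel₀ _ two_ne_zero]
      exact hmin hx
    linarith [neg_le_of_abs_le hshift]
  · have hdist : |w - x| ≤ δ + |v| + b := by
      rw [abs_le] at *
      constructor <;> linarith [abs_lt.1 hw, hx.1, hx.2, neg_abs_le v, le_abs_self v]
    have := (le_abs_self _).trans_eq (abs_mul (2 * θ) (w - x))
    rw [abs_mul, abs_two] at this
    linarith [mul_le_mul_of_nonneg_left hdist (by positivity : 0 ≤ 2 * |θ|)]

theorem eventually_isProbabilityMeasure_empiricalMeasure (γ : (N : ℕ) → Fin N → ℝ) :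
    ∀ᶠ N in atTop, IsProbabilityMeasure (empiricalMeasure (γ N)) := by
  filter_upwards [eventually_ne_atTop 0] with N hN
  have := NeZero.mk hN
  infer_instance

variable [IsProbabilityMeasure ρ]

theorem measure_Icc_ne_zero_of_tendsto_wasserstein1 (hb : 0 ≤ b) (hγ : ∀ N i, γ N i ∈ Icc 0 b)
    (hρ : Tendsto (fun N => wasserstein1 (empiricalMeasure (γ N)) ρ) atTop (𝓝 0)) :
    ρ (Icc 0 b) ≠ 0 := by
  have hae := ae_mem_of_tendsto_wasserstein1 (eventually_isProbabilityMeasure_empiricalMeasure γ)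
    hρ isClosed_Icc (nonempty_Icc.2 hb)
    (Eventually.of_forall fun N => ae_empiricalMeasure_of_forall (hγ N))
  rw [(mem_ae_iff_prob_eq_one measurableSet_Icc).1 hae]
  exact one_ne_zero

theorem eventually_exists_sum_one_div_saddleWeight (hb : 0 ≤ b) (hγ : ∀ N i, γ N i ∈ Icc 0 b)
    (hρ : Tendsto (fun N => wasserstein1 (empiricalMeasure (γ N)) ρ) atTop (𝓝 0))
    (hθ : θ ∈ highTemp ρ b) {ε : ℝ} (hε : 0 < ε) :
    ∀ᶠ N : ℕ in atTop, ∃ w, |w - limitEnergy ρ b θ| < ε ∧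
      ∑ i, 1 / saddleWeight θ w (γ N) i = N := by
  have hprob := eventually_isProbabilityMeasure_empiricalMeasure γ
  have hρb := measure_Icc_ne_zero_of_tendsto_wasserstein1 hb hγ hρ
  have hlim (z : ℝ) (hz : z ∉ Icc 0 b) := tendsto_stieltjes_of_tendsto_wasserstein1 hb hprob
    (Eventually.of_forall fun N => ae_empiricalMeasure_of_forall (hγ N)) hρ hz
  filter_upwards [eventually_exists_stieltjes_eq hρb hprob hlim (stieltjesInv_notMem hρb hθ) hε,
    eventually_ne_atTop 0] with N ⟨κ, hκ, hstieltjes⟩ hN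
  have := NeZero.mk hN
  refine ⟨κ - 1 / (2 * θ), by rwa [limitEnergy, rTransform, sub_sub_sub_cancel_right], ?_⟩
  rw [stieltjes_stieltjesInv hρb hθ, stieltjes_empiricalMeasure (hγ N)] at hstieltjes
  have hθ₀ : θ ≠ 0 := hθ.2.2
  have hweight (i : Fin N) :
      1 / saddleWeight θ (κ - 1 / (2 * θ)) (γ N) i = (2 * θ)⁻¹ * (1 / (κ - γ N i)) := by
    rw [← one_div, one_div_mul_one_div, saddleWeight]
    congr 1
    field_simp
    ring
  simp only [hweight, ← Finset.mul_sum]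
  rw [inv_mul_eq_iff_eq_mul₀ (by positivity), mul_comm, ← inv_mul_eq_iff_eq_mul₀ (by positivity)]
  exact hstieltjes

theorem exists_saddleWeight_bounds (hb : 0 ≤ b) (hγ : ∀ N i, γ N i ∈ Icc 0 b)
    (hρ : Tendsto (fun N => wasserstein1 (empiricalMeasure (γ N)) ρ) atTop (𝓝 0))
    (hθ : θ ∈ highTemp ρ b) :
    ∃ m M : ℝ, 0 < m ∧ 1 ≤ M ∧
      (∀ N i, saddleWeight θ (limitEnergy ρ b θ) (γ N) i ∈ Icc m M) ∧
      ∀ ε > 0, ∀ᶠ N : ℕ in atTop, ∃ w, |w - limitEnergy ρ b θ| < ε ∧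
        (∀ i, saddleWeight θ w (γ N) i ∈ Icc m M) ∧ ∑ i, 1 / saddleWeight θ w (γ N) i = N := by
  have hρb := measure_Icc_ne_zero_of_tendsto_wasserstein1 hb hγ hρ
  obtain ⟨m, M, δ, hm, hM, hδ, hbounds⟩ := exists_forall_abs_sub_lt_imp_mem_Icc hb
    fun x hx => one_add_mul_limitEnergy_sub_pos hρb hθ hx
  refine ⟨m, M, hm, hM, fun N i => hbounds _ (by simpa using hδ) _ (hγ N i), fun ε hε => ?_⟩
  filter_upwards [eventually_exists_sum_one_div_saddleWeight hb hγ hρ hθ (lt_min hε hδ)]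
    with N ⟨w, hw, hsum⟩
  exact ⟨w, hw.trans_le (min_le_left _ _),
    fun i => hbounds w (hw.trans_le (min_le_right _ _)) _ (hγ N i), hsum⟩

theorem exists_eventually_gibbsMean_pow_four_le (hb : 0 ≤ b) (hγ : ∀ N i, γ N i ∈ Icc 0 b)
    (hρ : Tendsto (fun N => wasserstein1 (empiricalMeasure (γ N)) ρ) atTop (𝓝 0))
    (hθ : θ ∈ highTemp ρ b) :
    ∃ C : ℝ, ∀ᶠ N in atTop, ∀ i, gibbsMean (γ N) θ (fun g => g i ^ 4) ≤ C := by
  obtain ⟨m, M, hm, -, -, hsaddle⟩ := exists_saddleWeight_bounds hb hγ hρ hθ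
  refine ⟨dominationConst m M * (M ^ 2 * (normalFourthMoment / m ^ 2)) *
    (normalFourthMoment + 1), ?_⟩
  filter_upwards [hsaddle 1 one_pos] with N ⟨w, _, hw, hsum⟩ i
  have : NeZero N := ⟨i.pos.ne'⟩
  rw [gibbsMean_eq_integral_rayleighGibbs (γ N) θ w]
  exact integral_pow_four_rayleighGibbs_le hm (fun i => (hw i).1) (fun i => (hw i).2)
    (hsum.trans (by rw [Fintype.card_fin])) i

theorem exists_eventually_energyError_le (hb : 0 ≤ b) (hγ : ∀ N i, γ N i ∈ Icc 0 b)
    (hρ : Tendsto (fun N => wasserstein1 (empiricalMeasure (γ N)) ρ) atTop (𝓝 0))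
    (hθ : θ ∈ highTemp ρ b) :
    ∃ C : ℝ, ∀ ε > 0, ∀ᶠ N : ℕ in atTop, energyError ρ b θ (γ N) ≤ C / N + 2 * ε ^ 2 := by
  obtain ⟨m, M, hm, -, -, hsaddle⟩ := exists_saddleWeight_bounds hb hγ hρ hθ
  set D := dominationConst m M * (M ^ 2 * (normalFourthMoment * (1 + 1 / m) ^ 2))
  refine ⟨2 * (D / (2 * θ) ^ 2), fun ε hε => ?_⟩
  filter_upwards [hsaddle ε hε, eventually_gt_atTop 0] with N ⟨w, hwε, hw, hsum⟩ hN
  have : NeZero N := ⟨hN.ne'⟩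
  have hθ₀ : θ ≠ 0 := hθ.2.2
  have hconc := card_mul_integral_sq_rayleigh_sub_one_le hm (fun i => (hw i).1)
    (fun i => (hw i).2) (hsum.trans (by rw [Fintype.card_fin]))
  rw [integral_sq_rayleigh_saddleWeight_sub_one, Fintype.card_fin] at hconc
  have hcritical : (gibbsMean (γ N) θ fun g => (energy (γ N) g - w) ^ 2) ≤
      D / (2 * θ) ^ 2 / N := by
    rw [le_div_iff₀ (Nat.cast_pos.2 hN), le_div_iff₀ (by positivity)]
    linarith
  have hshift : (w - limitEnergy ρ b θ) ^ 2 ≤ ε ^ 2 := sq_le_sq' (abs_lt.1 hwε).1.le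
    (abs_lt.1 hwε).2.le
  calc energyError ρ b θ (γ N)
    _ ≤ 2 * (gibbsMean (γ N) θ fun g => (energy (γ N) g - w) ^ 2) +
          2 * (w - limitEnergy ρ b θ) ^ 2 :=
      gibbsMean_sq_energy_sub_le hb (hγ N) fun i => hm.le.trans (hw i).1
    _ ≤ 2 * (D / (2 * θ) ^ 2 / N) + 2 * ε ^ 2 := by gcongr
    _ = 2 * (D / (2 * θ) ^ 2) / N + 2 * ε ^ 2 := by rw [mul_div_assoc (2 : ℝ)]

theorem tendsto_energyError (hb : 0 ≤ b) (hγ : ∀ N i, γ N i ∈ Icc 0 b)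
    (hρ : Tendsto (fun N => wasserstein1 (empiricalMeasure (γ N)) ρ) atTop (𝓝 0))
    (hθ : θ ∈ highTemp ρ b) : Tendsto (fun N => energyError ρ b θ (γ N)) atTop (𝓝 0) := by
  obtain ⟨C, hC⟩ := exists_eventually_energyError_le hb hγ hρ hθ
  refine tendsto_order.2 ⟨fun η hη => Eventually.of_forall fun N => hη.trans_le energyError_nonneg,
    fun η hη => ?_⟩
  filter_upwards [hC (√(η / 4)) (by positivity),
    (tendsto_const_div_atTop_nhds_zero_nat C).eventually_lt_const (half_pos hη)] with N hN hN'
  rw [Real.sq_sqrt (by positivity)] at hN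
  linarith

theorem tendsto_rate (hb : 0 ≤ b) (hγ : ∀ N i, γ N i ∈ Icc 0 b)
    (hρ : Tendsto (fun N => wasserstein1 (empiricalMeasure (γ N)) ρ) atTop (𝓝 0))
    (hθ : θ ∈ highTemp ρ b) : Tendsto (fun N => rate ρ b θ (γ N)) atTop (𝓝 0) := by
  have hsqrt : Tendsto (fun N : ℕ => 1 / √(N : ℝ)) atTop (𝓝 0) := by
    simp only [one_div]
    exact tendsto_inv_atTop_zero.comp (Real.tendsto_sqrt_atTop.comp tendsto_natCast_atTop_atTop)
  simpa [rate] using hsqrt.add (tendsto_energyError hb hγ hρ hθ).sqrt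

theorem exists_abs_gibbsMean_sub_le (hb : 0 ≤ b) (hγ : ∀ N i, γ N i ∈ Icc 0 b)
    (hρ : Tendsto (fun N => wasserstein1 (empiricalMeasure (γ N)) ρ) atTop (𝓝 0))
    (hθ : θ ∈ highTemp ρ b) (k : ℕ) :
    ∃ K : ℝ, 0 < K ∧ ∀ (N : ℕ) [NeZero N] (d : Fin k → Fin N), Function.Injective d →
      ∀ (f : (Fin k → ℝ) → ℝ) (B : ℝ), Measurable f → (∀ x, |f x| ≤ B) →
        |gibbsMean (γ N) θ (fun g => f fun i => g (d i)) -
            ∫ x, f x ∂(Measure.pi fun i => marginalLaw ρ b θ (γ N (d i)))|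
          ≤ K * B * rate ρ b θ (γ N) := by
  obtain ⟨m, M, hm, hM, hl, -⟩ := exists_saddleWeight_bounds hb hγ hρ hθ
  obtain ⟨C, hC⟩ := exists_eventually_gibbsMean_pow_four_le hb hγ hρ hθ
  obtain ⟨N₀, hN₀⟩ := eventually_atTop.1 hC
  refine ⟨max (2 * exchangeConst M (max C (normalFourthMoment / m ^ 2)) k * (1 + 2 * |θ|))
    (2 * √((N₀ + 1 : ℕ) : ℝ)), lt_max_of_lt_right (by positivity), fun N _ d hd f B hf hB => ?_⟩
  have hB₀ : 0 ≤ B := (abs_nonneg _).trans (hB 0)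
  have hrate : 0 ≤ B * rate ρ b θ (γ N) := mul_nonneg hB₀ rate_pos.le
  rw [mul_assoc]
  rcases le_or_gt N₀ N with hlarge | hsmall
  · refine le_trans ?_ (mul_le_mul_of_nonneg_right (le_max_left _ _) hrate)
    rw [← mul_assoc]
    exact abs_gibbsMean_sub_le_mul_rate hm hM (hl N) (hN₀ N hlarge) hd hf hB
  · refine le_trans ?_ (mul_le_mul_of_nonneg_right (le_max_right _ _) hrate)
    refine (abs_gibbsMean_sub_le_two_mul (fun i => hm.le.trans (hl N i).1) hB).trans ?_
    calc 2 * B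
      _ ≤ 2 * B * (√((N₀ + 1 : ℕ) : ℝ) * rate ρ b θ (γ N)) :=
        le_mul_of_one_le_right (by positivity) (one_le_sqrt_mul_rate (by lia))
      _ = 2 * √((N₀ + 1 : ℕ) : ℝ) * (B * rate ρ b θ (γ N)) := by ring

end Limit

section GaussianConvergence

variable {ι α : Type*} [Fintype ι] {u : Filter α}

theorem gaussianPi_eq_map_gaussianPi_one (l : ι → ℝ) :
    gaussianPi l = (gaussianPi fun _ => 1).map
      fun x i => √(Real.toNNReal (1 / l i) : ℝ) * x i := by
  simp only [gaussianPi, one_div_one, Real.toNNReal_one]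
  rw [Measure.pi_map_pi (f := fun i x => √(Real.toNNReal (1 / l i) : ℝ) * x) fun i => by fun_prop]
  simp only [← gaussianReal_eq_map]

theorem tendsto_integral_gaussianPi [u.IsCountablyGenerated] {l : α → ι → ℝ} {l₀ : ι → ℝ}
    (hl₀ : ∀ i, l₀ i ≠ 0) (hl : ∀ i, Tendsto (fun n => l n i) u (𝓝 (l₀ i))) (f : (ι → ℝ) →ᵇ ℝ) :
    Tendsto (fun n => ∫ x, f x ∂(gaussianPi (l n))) u (𝓝 (∫ x, f x ∂(gaussianPi l₀))) := by
  have hscale (l : ι → ℝ) : ∫ x, f x ∂(gaussianPi l) =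
      ∫ x, f (fun i => √(Real.toNNReal (1 / l i) : ℝ) * x i) ∂(gaussianPi fun _ => 1) := by
    rw [gaussianPi_eq_map_gaussianPi_one l, integral_map (Measurable.aemeasurable (by fun_prop))
      f.continuous.aestronglyMeasurable]
  simp only [hscale]
  refine tendsto_integral_filter_of_dominated_convergence (fun _ => ‖f‖)
    (Eventually.of_forall fun n => ?_) (Eventually.of_forall fun n => ae_of_all _ fun x =>
      f.norm_coe_le_norm _) (integrable_const _) (ae_of_all _ fun x => ?_)
  · exact (f.continuous.comp (by fun_prop)).aestronglyMeasurable
  · have hvar (i : ι) : Tendsto (fun n => Real.toNNReal (1 / l n i)) u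
        (𝓝 (Real.toNNReal (1 / l₀ i))) :=
      (continuous_real_toNNReal.tendsto _).comp (tendsto_const_nhds.div (hl i) (hl₀ i))
    exact (f.continuous.tendsto _).comp (tendsto_pi_nhds.2 fun i =>
      (NNReal.tendsto_coe.2 (hvar i)).sqrt.mul_const _)

theorem tendsto_integral_pi_marginalLaw [u.IsCountablyGenerated] {ρ : Measure ℝ} {b θ : ℝ}
    {x : α → ι → ℝ} {x₀ : ι → ℝ} (hx₀ : ∀ i, 1 + 2 * θ * (limitEnergy ρ b θ - x₀ i) ≠ 0)
    (hx : ∀ i, Tendsto (fun n => x n i) u (𝓝 (x₀ i))) (f : (ι → ℝ) →ᵇ ℝ) :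
    Tendsto (fun n => ∫ y, f y ∂(Measure.pi fun i => marginalLaw ρ b θ (x n i))) u
      (𝓝 (∫ y, f y ∂(Measure.pi fun i => marginalLaw ρ b θ (x₀ i)))) :=
  tendsto_integral_gaussianPi hx₀
    (fun i => (((hx i).const_sub (limitEnergy ρ b θ)).const_mul (2 * θ)).const_add 1) f

end GaussianConvergence

end SphericalModel

theorem corollary1
    -- the eigenvalues `γ N i`, `i < N`, lie in `[0, b]`, and their empirical measures converge to `ρ`
    (b : ℝ) (hb : 0 < b)
    (γ : (N : ℕ) → Fin N → ℝ) (hγ : ∀ N i, γ N i ∈ Icc 0 b)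
    (ρ : Measure ℝ) [IsProbabilityMeasure ρ]
    (hρ : Tendsto (fun N => SphericalModel.wasserstein1
      (SphericalModel.empiricalMeasure (γ N)) ρ) atTop (𝓝 0))
    (θ : ℝ) (hθ : θ ∈ SphericalModel.highTemp ρ b)
    (k : ℕ) (hk : 1 ≤ k) :
    -- the Gaussian variances are well defined and positive
    (∀ x ∈ Icc 0 b, 0 < 1 + 2 * θ * (SphericalModel.limitEnergy ρ b θ - x)) ∧
    -- the quantitative bound
    (∃ K : ℝ, 0 < K ∧ ∀ (N : ℕ) (d : Fin k → Fin N), Function.Injective d →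
      ∀ f : (Fin k → ℝ) → ℝ, Measurable f → (∃ C, ∀ x, |f x| ≤ C) →
        |SphericalModel.gibbsMean (γ N) θ (fun g => f fun i => g (d i)) -
            ∫ x, f x ∂(Measure.pi fun i => SphericalModel.marginalLaw ρ b θ (γ N (d i)))|
          ≤ K * (⨆ x, |f x|) * SphericalModel.rate ρ b θ (γ N)) ∧
    -- the rate vanishes
    Tendsto (fun N => SphericalModel.rate ρ b θ (γ N)) atTop (𝓝 0) ∧
    -- weak convergence of the finite marginals, along any sizes `n m → ∞` and distinct indices
    (∀ (n : ℕ → ℕ), Tendsto n atTop atTop →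
      ∀ d : (m : ℕ) → Fin k → Fin (n m), (∀ m, Function.Injective (d m)) →
        (∀ f : (Fin k → ℝ) →ᵇ ℝ,
          Tendsto (fun m =>
            SphericalModel.gibbsMean (γ (n m)) θ (fun g => f fun i => g (d m i)) -
              ∫ x, f x ∂(Measure.pi fun i =>
                SphericalModel.marginalLaw ρ b θ (γ (n m) (d m i)))) atTop (𝓝 0)) ∧
        (∀ c : Fin k → ℝ, (∀ i, Tendsto (fun m => γ (n m) (d m i)) atTop (𝓝 (c i))) →
          ∀ f : (Fin k → ℝ) →ᵇ ℝ,
            Tendsto (fun m =>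
              SphericalModel.gibbsMean (γ (n m)) θ (fun g => f fun i => g (d m i))) atTop
              (𝓝 (∫ x, f x ∂(Measure.pi fun i => SphericalModel.marginalLaw ρ b θ (c i)))))) := by
  have hρb := SphericalModel.measure_Icc_ne_zero_of_tendsto_wasserstein1 hb.le hγ hρ
  have hpos : ∀ x ∈ Icc 0 b, 0 < 1 + 2 * θ * (SphericalModel.limitEnergy ρ b θ - x) :=
    fun x hx => SphericalModel.one_add_mul_limitEnergy_sub_pos hρb hθ hx
  obtain ⟨K, hK, hbound⟩ := SphericalModel.exists_abs_gibbsMean_sub_le hb.le hγ hρ hθ k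
  have hrate := SphericalModel.tendsto_rate hb.le hγ hρ hθ
  have hneZero {N : ℕ} (d : Fin k → Fin N) : NeZero N := ⟨(d ⟨0, hk⟩).pos.ne'⟩
  refine ⟨hpos, ⟨K, hK, fun N d hd f hf ⟨C, hC⟩ => ?_⟩, hrate, fun n hn d hd => ?_⟩
  · have := hneZero d
    exact hbound N d hd f _ hf (le_ciSup ⟨C, forall_mem_range.2 hC⟩)
  have hdiff (f : (Fin k → ℝ) →ᵇ ℝ) : Tendsto (fun m =>
      SphericalModel.gibbsMean (γ (n m)) θ (fun g => f fun i => g (d m i)) -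
        ∫ x, f x ∂(Measure.pi fun i =>
          SphericalModel.marginalLaw ρ b θ (γ (n m) (d m i)))) atTop (𝓝 0) := by
    refine squeeze_zero_norm (fun m => ?_) (by simpa using (hrate.comp hn).const_mul (K * ‖f‖))
    have := hneZero (d m)
    exact hbound (n m) (d m) (hd m) f ‖f‖ f.continuous.measurable f.norm_coe_le_norm
  refine ⟨hdiff, fun c hc f => ?_⟩
  have hcb (i : Fin k) : c i ∈ Icc 0 b :=
    isClosed_Icc.mem_of_tendsto (hc i) (Eventually.of_forall fun m => hγ _ _)
  simpa using (hdiff f).add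
    (SphericalModel.tendsto_integral_pi_marginalLaw (fun i => (hpos _ (hcb i)).ne') hc f)
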